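/- **Conventions.** A partial function $F:\subseteq\{0,1\}^{\mathbb N}\to\{0,1\}^{\mathbb N}$ is computable if a Type-2 machine, reading longer and longer prefixes of $p\in\operatorname{dom}F$, writes longer and longer prefixes of $F(p)$ on a write-once output tape, i.e. if there is a computable prefix-monotone map $h$ on finite binary words such that for each $p\in\operatorname{dom}F$ the words $h(p_{<m})$, $m\in\mathbb N$, are prefixes of $F(p)$ of unbounded length (with no requirement outside $\operatorname{dom}F$). A represented space $\mathbf X=(X,\delta_X)$ is a set $X$ with a partial surjection $\delta_X:\subseteq\{0,1\}^{\mathbb N}\to X$. For a partial multivalued function $f:\subseteq\mathbf X\rightrightarrows\mathbf Y$ with $\operatorname{dom} f=\{x: f(x)\neq\emptyset\}$, a partial function $F:\subseteq\{0,1\}^{\mathbb N}\to\{0,1\}^{\mathbb N}$ is a realizer of $f$, written $F\vdash f$, if $\delta_Y(F(p))\in f(\delta_X(p))$ for all $p\in\operatorname{dom}(f\delta_X)$. We write $f\le_W g$ if there are computable $K,H:\subseteq\{0,1\}^{\mathbb N}\to\{0,1\}^{\mathbb N}$ such that $p\mapsto K\langle p,G(H(p))\rangle$ is a realizer of $f$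 for every $G\vdash g$; $f<_W g$ means $f\le_W g$ and $g\not\le_W f$; $f\equiv_W g$ means $f\le_W g$ and $g\le_W f$. **Spaces.** $\{0,1\}^{\mathbb N}$ is represented by the identity; $\mathbb N$ by $\delta_{\mathbb N}^{-1}(n)=\{0^n1^\omega\}$; Sierpiński space $\mathbb S=\{\bot,\top\}$ by $\delta_{\mathbb S}(0^\omega)=\bot$ and $\delta_{\mathbb S}(p)=\top$ for $p\ne0^\omega$; $\mathcal A(\mathbb N)$, the space of all subsets of $\mathbb N$, by $\psi$ with $n\in\psi(p)$ iff $01^{n+1}0$ is not a subword of $p$. Sequence spaces $\mathbf X^{\mathbb N}$, in particular $\mathbb N^{\mathbb N}$, carry the product representation, in which $p$ names $(x_n)_n$ iff $i\mapsto p(\langle n,i\rangle)$ names $x_n$ for every $n$. **Problems.** - $\mathrm C_{\mathbb N}:\subseteq\mathcal A(\mathbb N)\rightrightarrows\mathbb N$, where $\mathrm C_{\mathbb N}(A)=A$ for $A\ne\emptyset$ (undefined at $\emptyset$); $\mathrm{TC}_{\mathbb N}:\mathcal A(\mathbb N)\rightrightarrows\mathbb N$, where $n\in\mathrm{TC}_{\mathbb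 N}(A)$ iff $n\in A$ or $A=\emptyset$. - $\mathsf{Sort}:\{0,1\}^{\mathbb N}\to\{0,1\}^{\mathbb N}$, where $\mathsf{Sort}(p)=0^n1^\omega$ if $p$ contains exactly $n$ zeros, and $\mathsf{Sort}(p)=0^\omega$ if $p$ contains infinitely many zeros. - $\widehat f:\subseteq\mathbf X^{\mathbb N}\rightrightarrows\mathbf Y^{\mathbb N}$, the parallelization $\widehat f(x_0,x_1,\dots)=f(x_0)\times f(x_1)\times\cdots$ of $f$. - $\lim:\subseteq\mathbb N^{\mathbb N}\to\mathbb N^{\mathbb N}$, $\lim(p)(n)=\lim_{i\to\infty}p(\langle n,i\rangle)$, defined when all these limits exist in the discrete space $\mathbb N$. - $\mathsf{isFinite}_{\mathbb S},\mathsf{isInfinite}_{\mathbb S}:\{0,1\}^{\mathbb N}\to\mathbb S$, where $\mathsf{isFinite}_{\mathbb S}(p)=\top$ iff $p$ contains only finitely many ones, and $\mathsf{isInfinite}_{\mathbb S}(p)=\top$ iff $p$ contains infinitely many ones. **Proposition.** 1. $\mathrm C_{\mathbb N}<_W\mathsf{Sort}<_W\widehat{\mathsf{Sort}}\equiv_W\lim$.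 2. $\mathsf{isInfinite}_{\mathbb S}<_W\mathrm{TC}_{\mathbb N}$. 3. $\mathsf{isFinite}_{\mathbb S}<_W\mathsf{Sort}$. 4. $\mathsf{isInfinite}_{\mathbb S}\not\le_W\mathsf{Sort}$. 5. $\mathsf{isFinite}_{\mathbb S}\not\le_W\mathrm{TC}_{\mathbb N}$. -/

import Mathlib

namespace TTE

/-- Cantor space of infinite binary sequences (`false` is the bit 0, `true` is the bit 1). -/
abbrev Cantor : Type := ℕ → Bool

/-- The prefix of length `n` of the infinite sequence `p`. -/
def initSeg (p : Cantor) (n : ℕ) : List Bool := (List.range n).map p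

/-- `h` is a monotone word function which, run on longer and longer prefixes of the input `p`,
writes longer and longer prefixes of the infinite sequence `q`: every finite output is a prefix
of `q`, and the lengths of the finite outputs are unbounded. -/
def Produces (h : List Bool → List Bool) (p q : Cantor) : Prop :=
  (∀ m, h (initSeg p m) = initSeg q (h (initSeg p m)).length) ∧
    ∀ n, ∃ m, n ≤ (h (initSeg p m)).length

/-- Type-2 computability of a partial function on Cantor space: there is a single algorithm
that turns finite prefixes of the input into finite prefixes of the output, where output once
written is never revised. Nothing is required on inputs outside the domain of `F`. -/
def IsComputable (F : Cantor →. Cantor) : Prop :=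
  ∃ h : List Bool → List Bool, Computable h ∧ (∀ u v, u <+: v → h u <+: h v) ∧
    ∀ p q, q ∈ F p → Produces h p q

/-- The interleaving `⟨p, q⟩ = p(0) q(0) p(1) q(1) …`. -/
def interleave (p q : Cantor) : Cantor := fun n => if n % 2 = 0 then p (n / 2) else q (n / 2)

/-- A represented space: a set with a partial surjection from Cantor space onto it. The partial
surjection is given by its graph: `IsName p x` says that `p` is in its domain with value `x`. -/
structure RepSpace where
  Carrier : Type
  IsName : Cantor → Carrier → Prop
  name_unique : ∀ p x y, IsName p x → IsName p y → x = y
  exists_name : ∀ x, ∃ p, IsName p x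

/-- Partial multivalued functions `f : ⊆ X ⇉ Y`; the domain consists of the `x` for which
`f x` is nonempty. -/
abbrev MultiFun (X Y : RepSpace) : Type := X.Carrier → Set Y.Carrier

/-- A total single-valued function as a multivalued function. -/
def MultiFun.ofFun {X Y : RepSpace} (f : X.Carrier → Y.Carrier) : MultiFun X Y := fun x => {f x}

/-- `F` is a realizer of `f`. -/
def Realizes {X Y : RepSpace} (F : Cantor →. Cantor) (f : MultiFun X Y) : Prop :=
  ∀ p x, X.IsName p x → (f x).Nonempty → ∃ q ∈ F p, ∃ y ∈ f x, Y.IsName q y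

/-- The partial function `K⟨id, G H⟩`, with its natural domain. -/
def reductionMap (K H G : Cantor →. Cantor) : Cantor →. Cantor := fun p =>
  (H p).bind fun r => (G r).bind fun s => K (interleave p s)

/-- Weihrauch reducibility. -/
def WLe {X Y Z W : RepSpace} (f : MultiFun X Y) (g : MultiFun Z W) : Prop :=
  ∃ K H : Cantor →. Cantor, IsComputable K ∧ IsComputable H ∧
    ∀ G : Cantor →. Cantor, Realizes G g → Realizes (reductionMap K H G) f

/-- Strict Weihrauch reducibility. -/
def WLt {X Y Z W : RepSpace} (f : MultiFun X Y) (g : MultiFun Z W) : Prop :=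
  WLe f g ∧ ¬ WLe g f

/-- Weihrauch equivalence. -/
def WEquiv {X Y Z W : RepSpace} (f : MultiFun X Y) (g : MultiFun Z W) : Prop :=
  WLe f g ∧ WLe g f

infix:50 " ≤ᵂ " => WLe
infix:50 " <ᵂ " => WLt
infix:50 " ≡ᵂ " => WEquiv

/-! The represented spaces. -/

/-- Cantor space, represented by the identity. -/
def cantorSpace : RepSpace where
  Carrier := Cantor
  IsName p x := p = x
  name_unique := fun _ _ _ h h' => h.symm.trans h'
  exists_name := fun x => ⟨x, rfl⟩

/-- The sequence `0ⁿ 1 1 1 …`. -/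
def unary (n : ℕ) : Cantor := fun k => decide (n ≤ k)

theorem unary_injective : Function.Injective unary := by
  intro m n h
  have h1 := congrFun h m
  have h2 := congrFun h n
  simp only [unary, le_refl, decide_true] at h1 h2
  have h3 : n ≤ m := of_decide_eq_true h1.symm
  have h4 : m ≤ n := of_decide_eq_true h2
  exact le_antisymm h4 h3

/-- The natural numbers; the only name of `n` is `0ⁿ 1 1 1 …`. -/
def natSpace : RepSpace where
  Carrier := ℕ
  IsName p n := p = unary n
  name_unique := fun _ _ _ h h' => unary_injective (h.symm.trans h')
  exists_name := fun n => ⟨unary n, rfl⟩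

/-- Sierpinski space, with truth values as points: `0 0 0 …` is the only name of `⊥ = False`, and
every other sequence is a name of `⊤ = True`. -/
def sierpinskiSpace : RepSpace where
  Carrier := Prop
  IsName p x := x ↔ ∃ n, p n = true
  name_unique := fun _ _ _ h h' => propext (h.trans h'.symm)
  exists_name := fun x => by
    by_cases hx : x
    · exact ⟨fun _ => true, iff_of_true hx ⟨0, rfl⟩⟩
    · exact ⟨fun _ => false, iff_of_false hx (by simp)⟩

/-- The finite word `0 1ⁿ⁺¹ 0` is a subword of `p`. -/
def HasBlock (p : Cantor) (n : ℕ) : Prop :=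
  ∃ a, p a = false ∧ (∀ j ≤ n, p (a + 1 + j) = true) ∧ p (a + n + 2) = false

/-- Every set of natural numbers is the set of blocks of some sequence. -/
theorem exists_hasBlock (B : Set ℕ) : ∃ p : Cantor, ∀ n, HasBlock p n ↔ n ∈ B := by
  classical
  let p : Cantor := fun i : ℕ => decide (i.sqrt - 1 ∈ B ∧ i < i.sqrt * i.sqrt + i.sqrt)
  have hsq : ∀ m i : ℕ, m * m ≤ i → i ≤ m * m + m + m → i.sqrt = m := by
    intro m i h1 h2
    obtain ⟨j, rfl⟩ := Nat.exists_eq_add_of_le h1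
    exact Nat.sqrt_add_eq m (by omega)
  have hp : ∀ m i : ℕ, m * m ≤ i → i ≤ m * m + m + m →
      (p i = true ↔ (m - 1 ∈ B ∧ i < m * m + m)) := by
    intro m i h1 h2
    simp only [p, decide_eq_true_eq, hsq m i h1 h2]
  refine ⟨p, fun n => ⟨?_, fun hn => ?_⟩⟩
  · rintro ⟨a, h0, h1, h2⟩
    obtain ⟨m, hm⟩ : ∃ m, m = (a + 1).sqrt := ⟨_, rfl⟩
    have hle : m * m ≤ a + 1 := hm ▸ Nat.sqrt_le (a + 1)
    have hup : a + 1 ≤ m * m + m + m := hm ▸ Nat.sqrt_le_add (a + 1)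
    have h3 := (hp m (a + 1) hle hup).1 (h1 0 (Nat.zero_le n))
    have ha : a + 1 = m * m := by
      by_contra hne
      have : p a = true := (hp m a (by omega) (by omega)).2 ⟨h3.1, by omega⟩
      rw [h0] at this
      exact Bool.false_ne_true this
    have hmn : m = n + 1 := by
      rcases lt_trichotomy m (n + 1) with h | h | h
      · have := (hp m (a + 1 + m) (by omega) (by omega)).1 (h1 m (by omega))
        omega
      · exact h
      · have := (hp m (a + n + 2) (by omega) (by omega)).2 ⟨h3.1, by omega⟩
        rw [h2] at this
        exact absurd this Bool.false_ne_true
    have h4 := h3.1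
    rw [hmn] at h4
    simpa using h4
  · obtain ⟨s, hs⟩ : ∃ s, s = n * n := ⟨_, rfl⟩
    have hs' : (n + 1) * (n + 1) = s + 2 * n + 1 := by rw [hs]; ring
    refine ⟨s + 2 * n, ?_, fun j hj => ?_, ?_⟩
    · have := hp n (s + 2 * n) (by omega) (by omega)
      by_contra hc
      have h5 := this.1 (by simpa using hc)
      rcases Nat.eq_zero_or_pos n with h6 | h6
      · subst h6
        omega
      · omega
    · exact (hp (n + 1) _ (by omega) (by omega)).2 ⟨by simpa using hn, by omega⟩
    · have := hp (n + 1) (s + 2 * n + n + 2) (by omega) (by omega)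
      by_contra hc
      have h5 := this.1 (by simpa using hc)
      omega

/-- The space of closed subsets of the (discrete) natural numbers, represented by negative
information: `n` is in the set named by `p` iff `0 1ⁿ⁺¹ 0` is not a subword of `p`. -/
def closedSetSpace : RepSpace where
  Carrier := Set ℕ
  IsName p A := ∀ n, n ∈ A ↔ ¬ HasBlock p n
  name_unique := fun _ _ _ h h' => Set.ext fun n => (h n).trans (h' n).symm
  exists_name := fun A => by
    obtain ⟨p, hp⟩ := exists_hasBlock Aᶜ
    exact ⟨p, fun n => by rw [hp n, Set.mem_compl_iff, not_not]⟩

/-- The space of sequences in `X`, with the product representation: a name of `(xₙ)` is a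
sequence `⟨p₀, p₁, …⟩` whose `n`-th component `i ↦ p ⟨n, i⟩` is a name of `xₙ`. -/
def seqSpace (X : RepSpace) : RepSpace where
  Carrier := ℕ → X.Carrier
  IsName p x := ∀ n, X.IsName (fun i => p (Nat.pair n i)) (x n)
  name_unique := fun _ _ _ h h' => funext fun n => X.name_unique _ _ _ (h n) (h' n)
  exists_name := fun x => by
    choose q hq using fun n => X.exists_name (x n)
    refine ⟨fun k => q k.unpair.1 k.unpair.2, fun n => ?_⟩
    simpa using hq n

/-- Baire space, the space of sequences of natural numbers. -/
def baireSpace : RepSpace := seqSpace natSpace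

/-! The problems. -/

/-- Parallelization of `f`. -/
def parallelization {X Y : RepSpace} (f : MultiFun X Y) :
    MultiFun (seqSpace X) (seqSpace Y) :=
  fun x => {y | ∀ n, y n ∈ f (x n)}

/-- Closed choice on the natural numbers; its domain consists of the nonempty sets. -/
def choiceNat : MultiFun closedSetSpace natSpace := fun A : Set ℕ => {n : ℕ | n ∈ A}

/-- The total continuation of closed choice on the natural numbers. -/
def totalChoiceNat : MultiFun closedSetSpace natSpace :=
  fun A : Set ℕ => {n : ℕ | n ∈ A ∨ A = ∅}

/-- The limit map on Baire space, `lim(p)(n) = lim_{i → ∞} p ⟨n, i⟩` (limits in the discrete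
space of natural numbers), defined when all these limits exist. -/
def limProblem : MultiFun baireSpace baireSpace := fun p : ℕ → ℕ =>
  {q : ℕ → ℕ | ∀ n, Filter.Tendsto (fun i => p (Nat.pair n i)) Filter.atTop (nhds (q n))}

open Classical in
/-- `0ⁿ 1 1 1 …` if `p` has exactly `n` zeros, and `0 0 0 …` if `p` has infinitely many zeros. -/
noncomputable def sortFun (p : Cantor) : Cantor :=
  if {i | p i = false}.Finite then unary {i | p i = false}.ncard else fun _ => false

/-- Sorting an infinite binary sequence. -/
noncomputable def sort : MultiFun cantorSpace cantorSpace :=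
  MultiFun.ofFun (X := cantorSpace) (Y := cantorSpace) sortFun

/-- Finitely many ones, with values in Sierpinski space. -/
def isFiniteS : MultiFun cantorSpace sierpinskiSpace :=
  MultiFun.ofFun (X := cantorSpace) (Y := sierpinskiSpace)
    fun p : Cantor => {i | p i = true}.Finite

/-- Infinitely many ones, with values in Sierpinski space. -/
def isInfiniteS : MultiFun cantorSpace sierpinskiSpace :=
  MultiFun.ofFun (X := cantorSpace) (Y := sierpinskiSpace)
    fun p : Cantor => {i | p i = true}.Infinite

end TTE

open TTE

/-! A reduction can be tested on names (`wle_iff`): H must turn an instance into an instance, and K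
must succeed on every solution of it.

Reductions. `Sort` counts zeros. To find the least element of a nonempty set, emit one zero for each
n at the first stage at which 0, …, n are all seen to be excluded; the sorted sequence is then a
name of that minimum. Flipping bits turns `Sort` into a test for finitely many ones. For total
choice, exclude n as soon as a one appears beyond n: if the ones are finite in number, any answer
bounds them, and otherwise every answer has a one beyond it. Bit m of `Sort p` is the limit of the
truth values of "at most m zeros so far", and conversely the limit of a convergent bit sequence is
found by sorting it and its complement and waiting for a one in either output.

Separations. Only continuity of K and H is used. (a) If K is fed a Sierpinski answer, a name of ⊤
may look like ⊥ for arbitrarily long, so a problem that is discontinuous on a suitable set S does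
not reduce (`not_wle_sierpinski`). (b) "n is excluded" and "at least n zeros" are open conditions on
the instance. Either all of them are dense, and by Baire category one instance meets all of them at
once, or one fails throughout a cylinder, where a single fixed answer then makes K decide something
discontinuous. (c) `Sort` has only countably many values, so its parallelization can be diagonalized
against all of them. -/

namespace TTE

/-! ### Weihrauch reducibility on the level of names -/

/-- `q` names a solution of the instance of `f` named by `p`. -/
def Sol {X Y : RepSpace} (f : MultiFun X Y) (p q : Cantor) : Prop :=
  ∃ x y, X.IsName p x ∧ y ∈ f x ∧ Y.IsName q y

theorem realizes_iff {X Y : RepSpace} (F : Cantor →. Cantor) (f : MultiFun X Y) :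
    Realizes F f ↔ ∀ p, (∃ q, Sol f p q) → ∃ q ∈ F p, Sol f p q := by
  constructor
  · rintro h p ⟨_, x, y, hx, hy, -⟩
    obtain ⟨q, hq, y, hy, hqy⟩ := h p x hx ⟨y, hy⟩
    exact ⟨q, hq, x, y, hx, hy, hqy⟩
  · rintro h p x hx ⟨y, hy⟩
    obtain ⟨q, hqy⟩ := Y.exists_name y
    obtain ⟨q, hq, x', y, hx', hy, hqy⟩ := h p ⟨q, x, y, hx, hy, hqy⟩
    obtain rfl := X.name_unique p x x' hx hx'
    exact ⟨q, hq, y, hy, hqy⟩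

/-- Realizers may be arbitrary functions, so any single solution `s` of any single instance occurs
as a value of some realizer; quantifying over realizers amounts to quantifying over solutions. -/
theorem wle_iff {X Y Z W : RepSpace} {f : MultiFun X Y} {g : MultiFun Z W} :
    f ≤ᵂ g ↔ ∃ K H : Cantor →. Cantor, IsComputable K ∧ IsComputable H ∧
      ∀ p, (∃ q, Sol f p q) → ∃ r ∈ H p, (∃ s, Sol g r s) ∧
        ∀ s, Sol g r s → ∃ q ∈ K (interleave p s), Sol f p q := by
  classical
  constructor
  · rintro ⟨K, H, hK, hH, h⟩
    refine ⟨K, H, hK, hH, fun p hp => ?_⟩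
    have key : ∀ G : Cantor →. Cantor, Realizes G g →
        ∃ r ∈ H p, ∃ s ∈ G r, ∃ q ∈ K (interleave p s), Sol f p q := by
      intro G hG
      obtain ⟨q, hq, hs⟩ := (realizes_iff _ f).1 (h G hG) p hp
      simp only [reductionMap, Part.mem_bind_iff] at hq
      obtain ⟨r, hr, s, hs', hq⟩ := hq
      exact ⟨r, hr, s, hs', q, hq, hs⟩
    have canon : ∀ r, ∃ s, (∃ s, Sol g r s) → Sol g r s := by
      intro r
      by_cases hr : ∃ s, Sol g r s
      · exact ⟨hr.choose, fun _ => hr.choose_spec⟩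
      · exact ⟨r, fun h => absurd h hr⟩
    choose c hc using canon
    -- A realizer undefined off the domain of `g` forces `r` to be an instance of `g`.
    obtain ⟨r, hr, s, hs, -⟩ := key
      (fun r => if ∃ s, Sol g r s then Part.some (c r) else Part.none)
      ((realizes_iff _ g).2 fun r hr => ⟨c r, by simp [hr], hc r hr⟩)
    have hdom : ∃ s, Sol g r s := by
      by_contra hd
      simp [hd] at hs
    refine ⟨r, hr, hdom, fun s hs => ?_⟩
    -- The chosen realizer is altered at the one point `r` so as to return `s`.
    obtain ⟨r', hr', s', hs', q, hq, hsol⟩ := key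
      (fun r' => Part.some (if r' = r then s else c r'))
      ((realizes_iff _ g).2 fun r' hr' => by
        by_cases h : r' = r
        · subst h
          exact ⟨s, by simp, hs⟩
        · exact ⟨c r', by simp [h], hc r' hr'⟩)
    obtain rfl := Part.mem_unique hr hr'
    simp only [if_true, Part.mem_some_iff] at hs'
    subst hs'
    exact ⟨q, hq, hsol⟩
  · rintro ⟨K, H, hK, hH, h⟩
    refine ⟨K, H, hK, hH, fun G hG => (realizes_iff _ f).2 fun p hp => ?_⟩
    obtain ⟨r, hr, hdom, hs⟩ := h p hp
    obtain ⟨s, hsG, hsol⟩ := (realizes_iff G g).1 hG r hdom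
    obtain ⟨q, hq, hqs⟩ := hs s hsol
    refine ⟨q, ?_, hqs⟩
    simp only [reductionMap, Part.mem_bind_iff]
    exact ⟨r, hr, s, hsG, hq⟩

/-! ### Prefixes and continuity -/

@[simp] theorem length_initSeg (p : Cantor) (n : ℕ) : (initSeg p n).length = n := by
  simp [initSeg]

theorem getElem?_initSeg (p : Cantor) (n i : ℕ) :
    (initSeg p n)[i]? = if i < n then some (p i) else none := by
  split_ifs with h <;> simp [initSeg, h]

theorem take_initSeg (p : Cantor) {m n : ℕ} (h : m ≤ n) :
    (initSeg p n).take m = initSeg p m := by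
  simp [initSeg, ← List.map_take, List.take_range, h]

theorem initSeg_prefix (p : Cantor) {m n : ℕ} (h : m ≤ n) : initSeg p m <+: initSeg p n :=
  take_initSeg p h ▸ List.take_prefix _ _

/-- `p` and `q` have the same prefix of length `n`. -/
def Agree (n : ℕ) (p q : Cantor) : Prop := ∀ i < n, p i = q i

theorem Agree.refl (n : ℕ) (p : Cantor) : Agree n p p := fun _ _ => rfl

theorem Agree.symm {n : ℕ} {p q : Cantor} (h : Agree n p q) : Agree n q p :=
  fun i hi => (h i hi).symm

theorem Agree.trans {n : ℕ} {p q r : Cantor} (h : Agree n p q) (h' : Agree n q r) :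
    Agree n p r := fun i hi => (h i hi).trans (h' i hi)

theorem Agree.mono {m n : ℕ} {p q : Cantor} (h : Agree n p q) (hmn : m ≤ n) : Agree m p q :=
  fun i hi => h i (hi.trans_le hmn)

theorem Agree.initSeg_eq {n : ℕ} {p q : Cantor} (h : Agree n p q) : initSeg p n = initSeg q n :=
  List.map_congr_left fun i hi => h i (List.mem_range.1 hi)

theorem Agree.interleave {n : ℕ} {p q r s : Cantor} (h : Agree n p q) (h' : Agree n r s) :
    Agree n (interleave p r) (interleave q s) := by
  intro i hi
  simp only [TTE.interleave]
  rw [h (i / 2) (by omega), h' (i / 2) (by omega)]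

theorem Produces.getElem? {h : List Bool → List Bool} {p q : Cantor} (hp : Produces h p q)
    {m i : ℕ} {b : Bool} (hb : (h (initSeg p m))[i]? = some b) : q i = b := by
  rw [hp.1 m, getElem?_initSeg] at hb
  split_ifs at hb
  exact Option.some.inj hb

theorem Produces.exists_getElem? {h : List Bool → List Bool} {p q : Cantor}
    (hp : Produces h p q) (i : ℕ) : ∃ m, (h (initSeg p m))[i]? = some (q i) := by
  obtain ⟨m, hm⟩ := hp.2 (i + 1)
  refine ⟨m, ?_⟩
  rw [hp.1 m, getElem?_initSeg, if_pos (by omega)]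

theorem IsComputable.continuous {F : Cantor →. Cantor} (hF : IsComputable F) {p q : Cantor}
    (hq : q ∈ F p) (k : ℕ) :
    ∃ m, ∀ p' q', Agree m p p' → q' ∈ F p' → Agree k q q' := by
  obtain ⟨h, -, -, hprod⟩ := hF
  obtain ⟨m, hm⟩ := (hprod p q hq).2 k
  refine ⟨m, fun p' q' hp' hq' i hi => ((hprod p' q' hq').getElem? (m := m) ?_).symm⟩
  rw [← hp'.initSeg_eq, (hprod p q hq).1 m, getElem?_initSeg, if_pos (by omega)]

theorem IsComputable.continuous_interleave {F : Cantor →. Cantor} (hF : IsComputable F)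
    {p s q : Cantor} (hq : q ∈ F (interleave p s)) (k : ℕ) :
    ∃ m, ∀ p' s' q', Agree m p p' → Agree m s s' → q' ∈ F (interleave p' s') → Agree k q q' := by
  obtain ⟨m, hm⟩ := hF.continuous hq k
  exact ⟨m, fun p' s' q' hp hs => hm _ _ (hp.interleave hs)⟩

/-- The sequence that follows `p` up to position `m` and is constant from then on. -/
def splice (p : Cantor) (m : ℕ) (b : Bool) : Cantor := fun i => if i < m then p i else b

theorem agree_splice (p : Cantor) (m : ℕ) (b : Bool) : Agree m p (splice p m b) :=
  fun i hi => by simp [splice, hi]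

theorem splice_of_le (p : Cantor) {m i : ℕ} (b : Bool) (h : m ≤ i) : splice p m b i = b := by
  simp [splice, h]

theorem finite_splice (p : Cantor) (m : ℕ) (b : Bool) : {i | splice p m b i = !b}.Finite :=
  (Set.finite_lt_nat m).subset fun i hi => by
    by_contra h
    simp [splice_of_le p b (not_lt.1 h)] at hi

theorem infinite_splice (p : Cantor) (m : ℕ) (b : Bool) : {i | splice p m b i = b}.Infinite :=
  (Set.infinite_of_forall_exists_gt fun a =>
    ⟨max m (a + 1), splice_of_le p b (le_max_left _ _), by simp⟩)

/-- A countable intersection of dense open subsets of Cantor space is dense. -/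
theorem exists_agree_forall (Q : ℕ → Cantor → Prop)
    (hQ : ∀ n p m, ∃ p', Agree m p p' ∧ ∃ m', ∀ p'', Agree m' p' p'' → Q n p'')
    (p : Cantor) (m : ℕ) : ∃ p', Agree m p p' ∧ ∀ n, Q n p' := by
  choose P hP M hM using hQ
  -- A stage is a point with the length of its committed prefix. Forcing that length up by at least
  -- one puts bit `i` in the committed prefix of stage `i + 1`, where the limit reads it.
  let step : ℕ → Cantor × ℕ → Cantor × ℕ := fun n a => (P n a.1 a.2, max (M n a.1 a.2) (a.2 + 1))
  let a : ℕ → Cantor × ℕ := fun n => Nat.rec (p, m) step n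
  have ha : ∀ n, a (n + 1) = step n (a n) := fun n => rfl
  have hlt : ∀ n, (a n).2 < (a (n + 1)).2 := fun n => by
    rw [ha]
    exact (Nat.lt_succ_self _).trans_le (le_max_right _ _)
  have hmono : StrictMono fun n => (a n).2 := strictMono_nat_of_lt_succ hlt
  have hag : ∀ n k, Agree (a n).2 (a n).1 (a (n + k)).1 := by
    intro n k
    induction k with
    | zero => exact Agree.refl _ _
    | succ k ih =>
      refine ih.trans (((hP (n + k) (a (n + k)).1 (a (n + k)).2).mono ?_))
      exact hmono.monotone (Nat.le_add_right n k)
  have hid : ∀ n, n ≤ (a n).2 := fun n => hmono.le_apply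
  have hlim : ∀ n, Agree (a n).2 (a n).1 fun i => (a (i + 1)).1 i := by
    intro n i hi
    rcases le_total n (i + 1) with h | h
    · obtain ⟨k, hk⟩ := Nat.exists_eq_add_of_le h
      have := hag n k i hi
      rw [← hk] at this
      exact this
    · obtain ⟨k, hk⟩ := Nat.exists_eq_add_of_le h
      have := hag (i + 1) k i (hid (i + 1))
      rw [← hk] at this
      exact this.symm
  refine ⟨fun i => (a (i + 1)).1 i, hlim 0, fun n => hM n (a n).1 (a n).2 _ ?_⟩
  exact (hlim (n + 1)).mono (le_max_left _ _)

/-- Course-of-values recursion on Cantor space. -/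
theorem exists_forall_eq (Φ : Cantor → ℕ → Bool)
    (hΦ : ∀ x y k, Agree k x y → Φ x k = Φ y k) : ∃ x : Cantor, ∀ k, x k = Φ x k := by
  let x : Cantor := fun k => Nat.strongRec
    (fun k ih => Φ (fun i => if h : i < k then ih i h else false) k) k
  refine ⟨x, fun k => ?_⟩
  have : x k = Φ (fun i => if i < k then x i else false) k := by
    simp only [x]
    rw [Nat.strongRec]
    simp
  rw [this]
  exact hΦ _ _ _ fun i hi => by simp [hi]

/-! ### Computability of maps given by approximations to single output bits -/

/-- `φ w n`, for longer and longer prefixes `w` of `p`, is eventually the bit `q n`, and never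
the other bit. -/
def Approximates (φ : List Bool → ℕ → Option Bool) (p q : Cantor) : Prop :=
  ∀ n, (∀ m b, φ (initSeg p m) n = some b → b = q n) ∧
    ∃ m₀, ∀ m ≥ m₀, (φ (initSeg p m) n).isSome

/-- The output written after `i` steps of reading `w`, one bit at a time. -/
def output (φ : List Bool → ℕ → Option Bool) (w : List Bool) (i : ℕ) : List Bool :=
  Nat.rec [] (fun i u => u ++ (φ (w.take i) u.length).toList) i

theorem output_succ (φ : List Bool → ℕ → Option Bool) (w : List Bool) (i : ℕ) :
    output φ w (i + 1) =
      output φ w i ++ (φ (w.take i) (output φ w i).length).toList := rfl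

theorem output_prefix (φ : List Bool → ℕ → Option Bool) (w : List Bool) {i j : ℕ} (h : i ≤ j) :
    output φ w i <+: output φ w j := by
  induction h with
  | refl => exact List.prefix_rfl
  | step _ ih => exact ih.trans (List.prefix_append _ _)

theorem output_congr (φ : List Bool → ℕ → Option Bool) {v w : List Bool} (h : v <+: w) {i : ℕ}
    (hi : i ≤ v.length) : output φ v i = output φ w i := by
  induction i with
  | zero => rfl
  | succ i ih =>
    obtain ⟨t, rfl⟩ := h
    rw [output_succ, output_succ, ih (by omega), List.take_append_of_le_length (by omega)]

theorem output_isPrefix {φ : List Bool → ℕ → Option Bool} {p q : Cantor}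
    (h : Approximates φ p q) (m i : ℕ) (hi : i ≤ m) :
    output φ (initSeg p m) i = initSeg q (output φ (initSeg p m) i).length := by
  induction i with
  | zero => simp [output, initSeg]
  | succ i ih =>
    have ih := ih (by omega)
    rw [output_succ, take_initSeg _ (by omega)]
    cases hb : φ (initSeg p i) (output φ (initSeg p m) i).length with
    | none => simpa using ih
    | some b =>
      have := (h _).1 _ _ hb
      conv_lhs => rw [ih]
      simp [initSeg, List.range_succ, this]

/-- `φ` need not be monotone in the word. The machine rereads its input bit by bit and at each step
appends the next output bit if `φ` currently supplies it; what it has written after `i` steps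
depends on `i` input bits only. -/
theorem exists_isComputable (φ : List Bool → ℕ → Option Bool) (hφ : Primrec₂ φ) :
    ∃ F : Cantor →. Cantor, IsComputable F ∧ ∀ p q, Approximates φ p q → q ∈ F p := by
  refine ⟨fun p => ⟨∃ q, Approximates φ p q, fun h => h.choose⟩,
    ⟨fun w => output φ w w.length, ?_, ?_, ?_⟩, ?_⟩
  · have hstep : Primrec₂ fun (w : List Bool) (a : ℕ × List Bool) =>
        a.2 ++ (φ (w.take a.1) a.2.length).toList := by
      refine Primrec.list_append.comp (Primrec.snd.comp Primrec.snd) ?_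
      refine Primrec.optionToList.comp (hφ.comp ?_ ?_)
      · exact Primrec.list_take.comp (Primrec.fst.comp Primrec.snd) Primrec.fst
      · exact Primrec.list_length.comp (Primrec.snd.comp Primrec.snd)
    exact (Primrec.nat_rec' Primrec.list_length (Primrec.const []) hstep).to_comp
  · intro u v huv
    simp only
    rw [output_congr φ huv le_rfl]
    exact output_prefix _ _ huv.length_le
  · rintro p q ⟨hex, rfl⟩
    have hq := hex.choose_spec
    refine ⟨fun m => ?_, fun n => ?_⟩
    · exact output_isPrefix hq m _ (by simp)
    · induction n with
      | zero => exact ⟨0, Nat.zero_le _⟩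
      | succ n ih =>
        obtain ⟨m, hm⟩ := ih
        obtain ⟨m₀, h₀⟩ := (hq n).2
        have hle := (output_prefix φ (initSeg p (max m m₀ + 1)) (i := m) (j := max m m₀)
          (le_max_left _ _)).length_le
        rw [← output_congr φ (initSeg_prefix p (le_max_left m m₀ |>.trans (Nat.le_succ _)))
          (by simp)] at hle
        simp only [length_initSeg] at hm
        refine ⟨max m m₀ + 1, ?_⟩
        simp only [length_initSeg]
        -- Past `m₀` the machine cannot be stuck at length `n`: either it is already beyond, or this
        -- step supplies bit `n`.
        rw [output_succ, take_initSeg _ (Nat.le_succ _), List.length_append]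
        rcases Nat.lt_or_ge n (output φ (initSeg p (max m m₀ + 1)) (max m m₀)).length with h | h
        · omega
        · have hn : (output φ (initSeg p (max m m₀ + 1)) (max m m₀)).length = n := by omega
          rw [hn]
          obtain ⟨b, hb⟩ := Option.isSome_iff_exists.1 (h₀ (max m m₀) (le_max_right _ _))
          simp [hb]
  · intro p q hq
    have hex : ∃ q, Approximates φ p q := ⟨q, hq⟩
    refine ⟨hex, funext fun n => ?_⟩
    obtain ⟨m₁, h₁⟩ := (hex.choose_spec n).2
    obtain ⟨b, hb⟩ := Option.isSome_iff_exists.1 (h₁ m₁ le_rfl)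
    exact ((hex.choose_spec n).1 _ _ hb).symm.trans ((hq n).1 _ _ hb)

/-- A criterion for Weihrauch reducibility. -/
theorem wle_of_approximates {X Y Z W : RepSpace} {f : MultiFun X Y} {g : MultiFun Z W}
    (κ η : List Bool → ℕ → Option Bool) (hκ : Primrec₂ κ) (hη : Primrec₂ η)
    (h : ∀ p, (∃ q, Sol f p q) → ∃ r, Approximates η p r ∧ (∃ s, Sol g r s) ∧
      ∀ s, Sol g r s → ∃ q, Approximates κ (interleave p s) q ∧ Sol f p q) : f ≤ᵂ g := by
  obtain ⟨K, hK, hK'⟩ := exists_isComputable κ hκ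
  obtain ⟨H, hH, hH'⟩ := exists_isComputable η hη
  refine wle_iff.2 ⟨K, H, hK, hH, fun p hp => ?_⟩
  obtain ⟨r, hr, hdom, hs⟩ := h p hp
  refine ⟨r, hH' _ _ hr, hdom, fun s hsol => ?_⟩
  obtain ⟨q, hq, hq'⟩ := hs s hsol
  exact ⟨q, hK' _ _ hq, hq'⟩


/-! ### Solutions of the problems -/

theorem sol_sort {p q : Cantor} : Sol sort p q ↔ q = sortFun p := by
  constructor
  · rintro ⟨x, y, rfl, hy, rfl⟩
    exact hy
  · rintro rfl
    exact ⟨p, _, rfl, rfl, rfl⟩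

theorem sol_isFiniteS {p q : Cantor} :
    Sol isFiniteS p q ↔ ({i | p i = true}.Finite ↔ ∃ n, q n = true) := by
  constructor
  · rintro ⟨x, y, rfl, rfl, h⟩
    exact h
  · intro h
    exact ⟨p, _, rfl, rfl, h⟩

theorem sol_isInfiniteS {p q : Cantor} :
    Sol isInfiniteS p q ↔ ({i | p i = true}.Infinite ↔ ∃ n, q n = true) := by
  constructor
  · rintro ⟨x, y, rfl, rfl, h⟩
    exact h
  · intro h
    exact ⟨p, _, rfl, rfl, h⟩

theorem sol_choiceNat {p q : Cantor} :
    Sol choiceNat p q ↔ ∃ n, q = unary n ∧ ¬ HasBlock p n := by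
  constructor
  · rintro ⟨A, n, hA, hn, rfl⟩
    exact ⟨n, rfl, (hA n).1 hn⟩
  · rintro ⟨n, rfl, hn⟩
    exact ⟨{k : ℕ | ¬ HasBlock p k}, n, fun _ => Iff.rfl, hn, rfl⟩

theorem sol_totalChoiceNat {p q : Cantor} :
    Sol totalChoiceNat p q ↔ ∃ n, q = unary n ∧ (¬ HasBlock p n ∨ ∀ k, HasBlock p k) := by
  constructor
  · rintro ⟨A, n, hA, hn, rfl⟩
    refine ⟨n, rfl, hn.imp (hA n).1 ?_⟩
    rintro rfl k
    by_contra hk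
    exact (hA k).2 hk
  · rintro ⟨n, rfl, hn⟩
    refine ⟨{k : ℕ | ¬ HasBlock p k}, n, fun _ => Iff.rfl, hn.imp id fun h => ?_, rfl⟩
    exact Set.eq_empty_of_forall_notMem fun k hk => hk (h k)

theorem sol_parallelization {X Y : RepSpace} {f : MultiFun X Y} {p q : Cantor} :
    Sol (parallelization f) p q ↔
      ∀ n, Sol f (fun i => p (Nat.pair n i)) (fun i => q (Nat.pair n i)) := by
  constructor
  · rintro ⟨x, y, hx, hy, hq⟩ n
    exact ⟨x n, y n, hx n, hy n, hq n⟩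
  · intro h
    choose x y hx hy hq using h
    exact ⟨x, y, hx, hy, hq⟩

theorem sol_parallelization_sort {p q : Cantor} :
    Sol (parallelization sort) p q ↔
      ∀ n i, q (Nat.pair n i) = sortFun (fun i => p (Nat.pair n i)) i := by
  simp only [sol_parallelization, sol_sort, funext_iff]

/-- With `encard` the cases of finitely and infinitely many zeros become one. -/
theorem sortFun_eq_true {p : Cantor} {i : ℕ} :
    sortFun p i = true ↔ {j | p j = false}.encard ≤ i := by
  by_cases h : {j | p j = false}.Finite
  · simp only [sortFun, h, if_true, unary, decide_eq_true_eq]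
    rw [← h.cast_ncard_eq, Nat.cast_le]
  · simp only [sortFun, h, if_false, Bool.false_eq_true, false_iff]
    rw [Set.encard_eq_top_iff.2 h]
    simp

theorem sortFun_eq_unary {p : Cantor} {n : ℕ} (h : {j | p j = false}.encard = n) :
    sortFun p = unary n := by
  funext i
  rw [Bool.eq_iff_iff, sortFun_eq_true, h]
  simp [unary]

theorem sortFun_eq_false {p : Cantor} {i : ℕ} (h : (i + 1 : ℕ) ≤ {j | p j = false}.encard) :
    sortFun p i = false := by
  rw [Bool.eq_false_iff, Ne, sortFun_eq_true]
  intro h'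
  have := h.trans h'
  rw [Nat.cast_le] at this
  omega

theorem sortFun_range (p : Cantor) :
    sortFun p = (fun _ => false) ∨ ∃ n, sortFun p = unary n := by
  unfold sortFun
  split_ifs
  · exact Or.inr ⟨_, rfl⟩
  · exact Or.inl rfl

theorem exists_agree_zeros {p : Cantor} {n : ℕ} (h : n ≤ {j | p j = false}.encard) :
    ∃ m, ∀ p', Agree m p p' → n ≤ {j | p' j = false}.encard := by
  obtain ⟨t, ht, htn⟩ := Set.exists_subset_encard_eq h
  have hfin : t.Finite := Set.finite_of_encard_eq_coe htn
  obtain ⟨m, hm⟩ := hfin.bddAbove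
  refine ⟨m + 1, fun p' hp' => htn ▸ Set.encard_le_encard fun i hi => ?_⟩
  exact (hp' i (Nat.lt_succ_of_le (hm hi))).symm.trans (ht hi)

theorem exists_agree_hasBlock {p : Cantor} {n : ℕ} (h : HasBlock p n) :
    ∃ m, ∀ p', Agree m p p' → HasBlock p' n := by
  obtain ⟨a, h0, h1, h2⟩ := h
  refine ⟨a + n + 3, fun p' hp' => ⟨a, ?_, fun j hj => ?_, ?_⟩⟩
  · rw [← hp' a (by omega), h0]
  · rw [← hp' _ (by omega), h1 j hj]
  · rw [← hp' _ (by omega), h2]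

theorem unary_eq_of_agree {m n : ℕ} (h : Agree (n + 1) (unary n) (unary m)) : m = n := by
  have h1 := h n (Nat.lt_succ_self n)
  rw [unary, unary, decide_eq_true le_rfl, eq_comm, decide_eq_true_eq] at h1
  have h2 := h m (by omega)
  simp only [unary, le_refl, decide_true, decide_eq_true_eq] at h2
  omega

/-! ### Non-reducibility -/

/-- A problem, none of whose solutions depends continuously on the instance on the set `S`,
is not reducible to any problem with values in Sierpinski space. -/
theorem not_wle_sierpinski {X Y Z : RepSpace} {f : MultiFun X Y} (S : Set Cantor)
    (hne : S.Nonempty) (hdom : ∀ p ∈ S, ∃ q, Sol f p q)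
    (hS : ∀ p ∈ S, ∀ q, Sol f p q →
      ∃ k, ∀ m, ∃ p' ∈ S, Agree m p p' ∧ ∀ q', Sol f p' q' → ¬ Agree k q q')
    (g : MultiFun Z sierpinskiSpace) : ¬ f ≤ᵂ g := by
  rw [wle_iff]
  rintro ⟨K, H, hK, hH, h⟩
  choose! r hr hd hs using h
  -- If ⊥ were an answer at `p`, K would commit to `k` bits after reading `m` zeros of its name.
  -- Every nearby instance has an answer whose name starts with `m` zeros, so its solution would
  -- share these bits. Hence ⊤ is an answer throughout `S`.
  have htop : ∀ p ∈ S, ∀ s, (∃ n, s n = true) → Sol g (r p) s := by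
    intro p hp s hst
    obtain ⟨s₀, z, v, hz, hv, hs₀⟩ := hd p (hdom p hp)
    rcases Classical.em v with hv' | hv'
    · exact ⟨z, v, hz, hv, iff_of_true hv' hst⟩
    exfalso
    have hbot : Sol g (r p) fun _ => false := ⟨z, v, hz, hv, iff_of_false hv' (by simp)⟩
    obtain ⟨q, hq, hsol⟩ := hs p (hdom p hp) _ hbot
    obtain ⟨k, hk⟩ := hS p hp q hsol
    obtain ⟨m, hm⟩ := hK.continuous_interleave hq k
    obtain ⟨p', hp', hag, hno⟩ := hk m
    obtain ⟨s', hs', hag'⟩ : ∃ s', Sol g (r p') s' ∧ Agree m (fun _ => false) s' := by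
      obtain ⟨s₁, z', v', hz', hv', hs₁⟩ := hd p' (hdom p' hp')
      rcases Classical.em v' with hv'' | hv''
      · exact ⟨unary m, ⟨z', v', hz', hv', iff_of_true hv'' ⟨m, by simp [unary]⟩⟩,
          fun i hi => by simp [unary, hi]⟩
      · exact ⟨fun _ => false, ⟨z', v', hz', hv', iff_of_false hv'' (by simp)⟩, Agree.refl _ _⟩
    obtain ⟨q', hq', hsol'⟩ := hs p' (hdom p' hp') _ hs'
    exact hno q' hsol' (hm _ _ _ hag hag' hq')
  obtain ⟨p, hp⟩ := hne
  -- With the constant answer 1 1 1 …, K would solve `f` continuously on `S`.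
  obtain ⟨q, hq, hsol⟩ := hs p (hdom p hp) _ (htop p hp (fun _ => true) ⟨0, rfl⟩)
  obtain ⟨k, hk⟩ := hS p hp q hsol
  obtain ⟨m, hm⟩ := hK.continuous_interleave hq k
  obtain ⟨p', hp', hag, hno⟩ := hk m
  obtain ⟨q', hq', hsol'⟩ := hs p' (hdom p' hp') _ (htop p' hp' (fun _ => true) ⟨0, rfl⟩)
  exact hno q' hsol' (hm _ _ _ hag (Agree.refl _ _) hq')

/-- On sequences with finitely many zeros, one further zero placed arbitrarily late changes the
sorted sequence at a fixed position. -/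
theorem not_sort_wle_sierpinski {Z : RepSpace} (g : MultiFun Z sierpinskiSpace) :
    ¬ sort ≤ᵂ g := by
  refine not_wle_sierpinski {p : Cantor | {i | p i = false}.Finite}
    ⟨fun _ => true, by simp⟩ (fun p _ => ⟨_, sol_sort.2 rfl⟩) ?_ g
  rintro p hp q hq
  obtain rfl := sol_sort.1 hq
  obtain ⟨n, hn⟩ : ∃ n : ℕ, {i | p i = false}.encard = n := ⟨_, hp.cast_ncard_eq.symm⟩
  obtain ⟨M, hM⟩ := hp.bddAbove
  refine ⟨n + 1, fun m => ?_⟩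
  obtain ⟨N, hN⟩ : ∃ N, N = max m (M + 1) := ⟨_, rfl⟩
  have hz : {i | Function.update p N false i = false} = insert N {i | p i = false} := by
    ext i
    by_cases h : i = N
    · subst h; simp
    · simp [h]
  refine ⟨Function.update p N false, ?_, fun i hi => ?_, ?_⟩
  · simp only [Set.mem_ofPred_eq, hz]
    exact hp.insert _
  · rw [Function.update_of_ne (by omega)]
  · rintro q' hq' hag
    obtain rfl := sol_sort.1 hq'
    have hz' : {i | Function.update p N false i = false}.encard = (n + 1 : ℕ) := by
      rw [hz, Set.encard_insert_of_notMem, hn]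
      · simp
      · intro h
        have := hM h
        omega
    rw [sortFun_eq_unary hn, sortFun_eq_unary hz'] at hag
    have := unary_eq_of_agree hag
    omega

theorem not_hasBlock_of_eventually_false {p : Cantor} {m : ℕ} (h : ∀ i, m ≤ i → p i = false) :
    ¬ HasBlock p m := by
  rintro ⟨a, -, h1, -⟩
  have := h1 m le_rfl
  rw [h _ (by omega)] at this
  simp at this

/-- On eventually zero names the set is nonempty, and any answer `n` can be spoiled by a late block
0 1ⁿ⁺¹ 0. -/
theorem not_totalChoiceNat_wle_sierpinski {Z : RepSpace} (g : MultiFun Z sierpinskiSpace) :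
    ¬ totalChoiceNat ≤ᵂ g := by
  have hS : ∀ p : Cantor, (∃ m, ∀ i, m ≤ i → p i = false) → ∃ n, ¬ HasBlock p n :=
    fun p ⟨m, hm⟩ => ⟨m, not_hasBlock_of_eventually_false hm⟩
  refine not_wle_sierpinski {p : Cantor | ∃ m, ∀ i, m ≤ i → p i = false}
    ⟨fun _ => false, 0, by simp⟩ ?_ ?_ g
  · intro p hp
    obtain ⟨n, hn⟩ := hS p hp
    exact ⟨_, sol_totalChoiceNat.2 ⟨n, rfl, Or.inl hn⟩⟩
  · intro p hp q hq
    obtain ⟨n, rfl, -⟩ := sol_totalChoiceNat.1 hq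
    refine ⟨n + 1, fun m => ?_⟩
    obtain ⟨p', hp'⟩ : ∃ p' : Cantor, p' = fun i => if i < m then p i else
      decide (m + 1 ≤ i ∧ i ≤ m + n + 1) := ⟨_, rfl⟩
    have hfin : ∃ m, ∀ i, m ≤ i → p' i = false :=
      ⟨m + n + 2, fun i hi => by
        rw [hp']
        simp only [if_neg (show ¬ i < m by omega), decide_eq_false_iff_not]
        omega⟩
    have hblock : HasBlock p' n := by
      refine ⟨m, by simp [hp'], fun j hj => ?_, ?_⟩
      · rw [hp']
        simp only [if_neg (show ¬ m + 1 + j < m by omega), decide_eq_true_eq]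
        omega
      · rw [hp']
        simp only [if_neg (show ¬ m + n + 2 < m by omega), decide_eq_false_iff_not]
        omega
    refine ⟨p', hfin, fun i hi => by simp [hp', hi], fun q' hq' hag => ?_⟩
    obtain ⟨n', rfl, hn'⟩ := sol_totalChoiceNat.1 hq'
    obtain rfl := unary_eq_of_agree hag
    obtain ⟨k, hk⟩ := hS p' hfin
    exact hn'.elim (fun h => h hblock) fun h => hk (h k)

/-! ### Separations by Baire category -/

theorem not_sort_wle_choiceNat : ¬ sort ≤ᵂ choiceNat := by
  rw [wle_iff]
  rintro ⟨K, H, hK, hH, h⟩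
  replace h := fun p => h p ⟨_, sol_sort.2 rfl⟩
  choose r hr hd hs using h
  -- If every exclusion is dense, some `p` is sent to the empty set. Otherwise one `n` is a correct
  -- answer on a whole cylinder, and sorting would be continuous there.
  by_cases hc : ∀ n p m, ∃ p', Agree m p p' ∧ HasBlock (r p') n
  · obtain ⟨p, -, hp⟩ := exists_agree_forall (fun n p => HasBlock (r p) n) (fun n p m => by
      obtain ⟨p', hag, hb⟩ := hc n p m
      obtain ⟨k, hk⟩ := exists_agree_hasBlock hb
      obtain ⟨l, hl⟩ := hH.continuous (hr p') k
      exact ⟨p', hag, l, fun p'' hp'' => hk _ (hl _ _ hp'' (hr p''))⟩) (fun _ => true) 0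
    obtain ⟨s, hs⟩ := hd p
    obtain ⟨n, -, hn⟩ := sol_choiceNat.1 hs
    exact hn (hp n)
  · push Not at hc
    obtain ⟨n, p₀, m, hno⟩ := hc
    have hval : ∀ p, Agree m p₀ p → sortFun p ∈ K (interleave p (unary n)) := by
      intro p hp
      obtain ⟨q, hq, hsol⟩ := hs p _ (sol_choiceNat.2 ⟨n, rfl, hno p hp⟩)
      rwa [← sol_sort.1 hsol]
    have hp := agree_splice p₀ m true
    have hfin : {i | splice p₀ m true i = false}.Finite := finite_splice p₀ m true
    have hN := sortFun_eq_true (p := splice p₀ m true)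
      (i := {i | splice p₀ m true i = false}.ncard) |>.2 hfin.cast_ncard_eq.symm.le
    obtain ⟨l, hl⟩ := hK.continuous_interleave (hval _ hp)
      ({i | splice p₀ m true i = false}.ncard + 1)
    have hp' := agree_splice (splice p₀ m true) (max l m) false
    have := hl _ _ _ (hp'.mono (le_max_left _ _)) (Agree.refl _ _)
      (hval _ (hp.trans (hp'.mono (le_max_right _ _)))) _ (Nat.lt_succ_self _)
    rw [hN, eq_comm, sortFun_eq_true,
      Set.encard_eq_top_iff.2 (infinite_splice (splice p₀ m true) (max l m) false)] at this
    simp at this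

theorem not_isFiniteS_wle_totalChoiceNat : ¬ isFiniteS ≤ᵂ totalChoiceNat := by
  rw [wle_iff]
  rintro ⟨K, H, hK, hH, h⟩
  replace h := fun p => h p ⟨_, ⟨p, _, rfl, rfl, (sierpinskiSpace.exists_name _).choose_spec⟩⟩
  choose r hr hd hs using h
  have hsol : ∀ p n, (¬ HasBlock (r p) n ∨ ∀ k, HasBlock (r p) k) →
      ∃ q ∈ K (interleave p (unary n)), ({i | p i = true}.Finite ↔ ∃ n, q n = true) := by
    intro p n hn
    obtain ⟨q, hq, hq'⟩ := hs p _ (sol_totalChoiceNat.2 ⟨n, rfl, hn⟩)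
    exact ⟨q, hq, sol_isFiniteS.1 hq'⟩
  -- On a finite `p`, K accepts with answer `n` after a finite prefix. Nearby infinite instances
  -- must not be accepted, so there `n` is a wrong answer: it is excluded and the set is nonempty.
  have hfin : ∀ p n m, {i | p i = true}.Finite →
      (¬ HasBlock (r p) n ∨ ∀ k, HasBlock (r p) k) →
      ∃ l ≥ m, ∀ p', Agree l p p' → {i | p' i = true}.Infinite →
        HasBlock (r p') n ∧ ∃ k, ¬ HasBlock (r p') k := by
    intro p n m hp hn
    obtain ⟨q, hq, hq'⟩ := hsol p n hn
    obtain ⟨i, hi⟩ := hq'.1 hp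
    obtain ⟨l, hl⟩ := hK.continuous_interleave hq (i + 1)
    refine ⟨max l m, le_max_right _ _, fun p' hag hinf => ?_⟩
    by_contra hcon
    obtain ⟨q₁, hq₁, hq₁'⟩ := hsol p' n (by
      by_contra h
      push Not at h
      exact hcon h)
    have := hl _ _ _ (hag.mono (le_max_left _ _)) (Agree.refl _ _) hq₁ i (Nat.lt_succ_self i)
    exact hinf (hq₁'.2 ⟨i, this.symm.trans hi⟩)
  have hzero : {i | (fun _ => false : Cantor) i = true}.Finite := by simp
  obtain ⟨s, hs₀⟩ := hd fun _ => false
  obtain ⟨n₀, -, hn₀⟩ := sol_totalChoiceNat.1 hs₀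
  obtain ⟨l, -, hl⟩ := hfin _ n₀ 0 hzero hn₀
  by_cases hc : ∀ n p m, Agree l (fun _ => false) p → l ≤ m →
      ∃ p', Agree m p p' ∧ HasBlock (r p') n
  · obtain ⟨p, hag, hp⟩ := exists_agree_forall
      -- The implication localizes the category argument to the cylinder of 0ˡ, where infinite
      -- instances give nonempty sets; the added ones make the generic `p` infinite.
      (fun n p => Agree l (fun _ => false) p →
        HasBlock (r p) n ∧ ∃ i, n < i ∧ p i = true) (fun n p m => by
      by_cases hag₀ : Agree l (fun _ => false) p
      swap
      · refine ⟨p, Agree.refl _ _, l, fun p'' hp'' hcon => absurd (hcon.trans hp''.symm) hag₀⟩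
      obtain ⟨p', hag, hb⟩ := hc n p (max l m) hag₀ (le_max_left _ _)
      obtain ⟨k, hk⟩ := exists_agree_hasBlock hb
      obtain ⟨l', hl'⟩ := hH.continuous (hr p') k
      obtain ⟨N, hN⟩ : ∃ N, N = max m (max l' (n + 1)) := ⟨_, rfl⟩
      have hsp := agree_splice p' N true
      refine ⟨splice p' N true, (hag.mono (le_max_right _ _)).trans (hsp.mono (by omega)), N + 1,
        fun p'' hp'' _ => ⟨hk _ (hl' _ _ ?_ (hr p'')), N, by omega, ?_⟩⟩
      · exact (hsp.mono (by omega)).trans (hp''.mono (by omega))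
      · rw [← hp'' N (Nat.lt_succ_self N), splice_of_le _ _ le_rfl]) (fun _ => false) l
    have hinf : {i | p i = true}.Infinite := Set.infinite_of_forall_exists_gt fun n => by
      obtain ⟨i, hi, hi'⟩ := (hp n hag).2
      exact ⟨i, hi', hi⟩
    obtain ⟨k, hk⟩ := (hl p hag hinf).2
    exact hk (hp k hag).1
  · push Not at hc
    obtain ⟨n, p₀, m, -, -, hno⟩ := hc
    have hp := agree_splice p₀ m false
    have hpf : {i | splice p₀ m false i = true}.Finite := finite_splice p₀ m false
    obtain ⟨l', hl', hall⟩ := hfin _ n m hpf (Or.inl (hno _ hp))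
    have hp' := agree_splice (splice p₀ m false) l' true
    exact hno _ (hp.trans (hp'.mono hl')) (hall _ hp' (infinite_splice _ _ true)).1

theorem not_isInfiniteS_wle_sort : ¬ isInfiniteS ≤ᵂ sort := by
  rw [wle_iff]
  rintro ⟨K, H, hK, hH, h⟩
  replace h := fun p => h p ⟨_, ⟨p, _, rfl, rfl, (sierpinskiSpace.exists_name _).choose_spec⟩⟩
  choose r hr _ hs using h
  have hsol : ∀ p, ∃ q ∈ K (interleave p (sortFun (r p))),
      ({i | p i = true}.Infinite ↔ ∃ n, q n = true) := by
    intro p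
    obtain ⟨q, hq, hq'⟩ := hs p _ (sol_sort.2 rfl)
    exact ⟨q, hq, sol_isInfiniteS.1 hq'⟩
  have hopen : ∀ p (n : ℕ), n ≤ {i | r p i = false}.encard →
      ∃ m, ∀ p', Agree m p p' → n ≤ {i | r p' i = false}.encard := by
    intro p n hn
    obtain ⟨k, hk⟩ := exists_agree_zeros hn
    obtain ⟨m, hm⟩ := hH.continuous (hr p) k
    exact ⟨m, fun p' hp' => hk _ (hm _ _ hp' (hr p'))⟩
  have hinf : ∀ p, {i | p i = true}.Infinite → ∃ m, ∀ p', Agree m p p' →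
      Agree m (sortFun (r p)) (sortFun (r p')) → {i | p' i = true}.Infinite := by
    intro p hp
    obtain ⟨q, hq, hq'⟩ := hsol p
    obtain ⟨i, hi⟩ := hq'.1 hp
    obtain ⟨m, hm⟩ := hK.continuous_interleave hq (i + 1)
    refine ⟨m, fun p' hag hag' => ?_⟩
    obtain ⟨q₁, hq₁, hq₁'⟩ := hsol p'
    exact hq₁'.2 ⟨i, (hm _ _ _ hag hag' hq₁ i (Nat.lt_succ_self i)).symm.trans hi⟩
  -- If the count could not be raised from `n` to `n + 1`, it would be exactly `n` on a cylinder,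
  -- the sorted answer would be constant there, and acceptance of an infinite instance would carry
  -- over to a finite one.
  have hdense : ∀ (n : ℕ) p m, ∃ p', Agree m p p' ∧ n ≤ {i | r p' i = false}.encard := by
    intro n p m
    induction n with
    | zero => exact ⟨p, Agree.refl _ _, by simp⟩
    | succ n ih =>
      obtain ⟨p', hag, hp'⟩ := ih
      obtain ⟨l, hl⟩ := hopen p' n hp'
      have h₁ := agree_splice p' (max l m) true
      by_contra hcon
      push Not at hcon
      have hex : ∀ p'', Agree (max l m) p' p'' → sortFun (r p'') = unary n := by
        intro p'' hp''
        have hlt := hcon p'' (hag.trans (hp''.mono (le_max_right _ _)))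
        have hle := hl p'' (hp''.mono (le_max_left _ _))
        refine sortFun_eq_unary (le_antisymm ?_ hle)
        rw [Nat.cast_add, Nat.cast_one] at hlt
        exact Order.le_of_lt_add_one hlt
      obtain ⟨k, hk⟩ := hinf _ (infinite_splice p' (max l m) true)
      have h₂ := agree_splice (splice p' (max l m) true) (max k (max l m)) false
      refine hk _ (h₂.mono (le_max_left _ _)) ?_ (finite_splice _ _ false)
      rw [hex _ h₁, hex _ (h₁.trans (h₂.mono (le_max_right _ _)))]
      exact Agree.refl _ _
  obtain ⟨p, -, hp⟩ := exists_agree_forall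
    (fun n p => n ≤ {i | r p i = false}.encard ∧ ∃ i, n < i ∧ p i = true) (fun n p m => by
      obtain ⟨p', hag, hb⟩ := hdense n p m
      obtain ⟨l, hl⟩ := hopen p' n hb
      obtain ⟨N, hN⟩ : ∃ N, N = max m (max l (n + 1)) := ⟨_, rfl⟩
      have hsp := agree_splice p' N true
      refine ⟨splice p' N true, hag.trans (hsp.mono (by omega)), N + 1,
        fun p'' hp'' => ⟨hl _ ?_, N, by omega, ?_⟩⟩
      · exact (hsp.mono (by omega)).trans (hp''.mono (by omega))
      · rw [← hp'' N (Nat.lt_succ_self N), splice_of_le _ _ le_rfl]) (fun _ => false) 0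
  have hpinf : {i | p i = true}.Infinite := Set.infinite_of_forall_exists_gt fun n => by
    obtain ⟨i, hi, hi'⟩ := (hp n).2
    exact ⟨i, hi', hi⟩
  -- Here `r p` has infinitely many zeros. K accepts after seeing `m` bits of the answer, all zero,
  -- and nearby finite instances still have answers starting with `m` zeros.
  obtain ⟨m, hm⟩ := hinf p hpinf
  obtain ⟨l, hl⟩ := hopen p m (hp m).1
  have hsp := agree_splice p (max l m) false
  refine hm _ (hsp.mono (le_max_right _ _)) (fun i hi => ?_) (finite_splice p (max l m) false)
  have hle : ((i + 1 : ℕ) : ℕ∞) ≤ m := Nat.cast_le.2 hi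
  rw [sortFun_eq_false (hle.trans (hp m).1),
    sortFun_eq_false (hle.trans (hl _ (hsp.mono (le_max_left _ _))))]

/-! ### Separation by diagonalization -/

theorem not_parallelization_sort_wle_sort : ¬ parallelization sort ≤ᵂ sort := by
  rw [wle_iff]
  rintro ⟨K, H, hK, hH, h⟩
  obtain ⟨κ, -, -, hκ⟩ := hK
  -- All possible values of `Sort`.
  let s : ℕ → Cantor := fun n => Nat.casesOn n (fun _ => false) unary
  -- Column `n` refutes K on the answer `s n`: it receives a zero exactly when K claims that its
  -- sorted form starts with 1, i.e. that it has no zeros. Bit `t` of the column uses only `t ≤ ⟨n,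
  -- t⟩` bits of `x`, so the recursion is well founded.
  obtain ⟨x, hx⟩ := exists_forall_eq
    (fun x k => !decide ((κ (initSeg (interleave x (s k.unpair.1)) k.unpair.2))[
      Nat.pair k.unpair.1 0]? = some true))
    (fun x y k hxy => by
      have : Agree k.unpair.2 (interleave x (s k.unpair.1)) (interleave y (s k.unpair.1)) :=
        (hxy.mono (Nat.unpair_right_le k)).interleave (Agree.refl _ _)
      simp only [this.initSeg_eq])
  obtain ⟨r, -, -, hs⟩ := h x
    ⟨fun j => sortFun (fun i => x (Nat.pair j.unpair.1 i)) j.unpair.2,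
      sol_parallelization_sort.2 fun n i => by simp⟩
  obtain ⟨n, hn⟩ : ∃ n, sortFun r = s n := by
    rcases sortFun_range r with h | ⟨n, h⟩
    · exact ⟨0, h⟩
    · exact ⟨n + 1, h⟩
  obtain ⟨q, hq, hsol⟩ := hs _ (sol_sort.2 rfl)
  rw [hn] at hq
  have hprod := hκ _ _ hq
  have hq0 := sol_parallelization_sort.1 hsol n 0
  have hxn : ∀ t, x (Nat.pair n t) = !decide ((κ (initSeg (interleave x (s n)) t))[
      Nat.pair n 0]? = some true) := fun t => by simpa using hx (Nat.pair n t)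
  cases hb : q (Nat.pair n 0) with
  | false =>
    have hall : ∀ t, x (Nat.pair n t) = true := fun t => by
      rw [hxn t]
      by_contra hcon
      simp only [Bool.not_eq_true, Bool.not_eq_false', decide_eq_true_eq] at hcon
      have := hprod.getElem? hcon
      simp [hb] at this
    rw [hb, eq_comm, Bool.eq_false_iff, Ne, sortFun_eq_true] at hq0
    simp [hall] at hq0
  | true =>
    rw [hb, eq_comm, sortFun_eq_true] at hq0
    simp only [Nat.cast_zero, nonpos_iff_eq_zero, Set.encard_eq_zero] at hq0
    obtain ⟨m, hm⟩ := hprod.exists_getElem? (Nat.pair n 0)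
    have : x (Nat.pair n m) = false := by
      rw [hxn m, hm, hb]
      simp
    exact Set.notMem_empty m (hq0 ▸ this)


/-! ### Reductions -/

/-- Wait for the first `t k` input bits before producing the output bit number `k`. -/
def afterReading (t : ℕ → ℕ) (β : List Bool → ℕ → Bool) (w : List Bool) (k : ℕ) : Option Bool :=
  if t k ≤ w.length then some (β w k) else none

theorem primrec_afterReading {t : ℕ → ℕ} {β : List Bool → ℕ → Bool} (ht : Primrec t)
    (hβ : Primrec₂ β) : Primrec₂ (afterReading t β) :=
  Primrec.ite (Primrec.nat_le.comp (ht.comp Primrec.snd) (Primrec.list_length.comp Primrec.fst))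
    (Primrec.option_some.comp hβ) (Primrec.const none)

theorem approximates_afterReading {t : ℕ → ℕ} {β : List Bool → ℕ → Bool} {p q : Cantor}
    (h : ∀ k m, t k ≤ m → β (initSeg p m) k = q k) : Approximates (afterReading t β) p q := by
  refine fun k => ⟨fun m b hb => ?_, t k, fun m hm => ?_⟩
  · simp only [afterReading, length_initSeg] at hb
    split_ifs at hb with hm
    rw [← h k m hm]
    exact (Option.some.inj hb).symm
  · simp only [afterReading, length_initSeg]
    rw [if_pos hm]
    rfl

theorem getD_initSeg (p : Cantor) {m i : ℕ} (d : Bool) (h : i < m) :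
    (initSeg p m).getD i d = p i := by
  rw [List.getD_eq_getElem?_getD, getElem?_initSeg, if_pos h]
  rfl

theorem interleave_odd (p s : Cantor) (k : ℕ) : interleave p s (2 * k + 1) = s k := by
  have h₁ : (2 * k + 1) % 2 ≠ 0 := by omega
  have h₂ : (2 * k + 1) / 2 = k := by omega
  simp only [interleave, h₁, if_false, h₂]

theorem interleave_even (p s : Cantor) (k : ℕ) : interleave p s (2 * k) = p k := by
  have h₁ : (2 * k) % 2 = 0 := by omega
  have h₂ : (2 * k) / 2 = k := by omega
  simp only [interleave, h₁, if_true, h₂]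

theorem primrec_getD {α : Type} [Primcodable α] {w : α → List Bool} {g : α → ℕ} (d : Bool)
    (hw : Primrec w) (hg : Primrec g) : Primrec fun a => (w a).getD (g a) d :=
  (Primrec.list_getD d).comp hw hg

theorem primrec_two_mul {α : Type} [Primcodable α] {g : α → ℕ} (hg : Primrec g) :
    Primrec fun a => 2 * g a := Primrec.nat_mul.comp (Primrec.const 2) hg

theorem primrec_unpair_fst {α : Type} [Primcodable α] {g : α → ℕ} (hg : Primrec g) :
    Primrec fun a => (g a).unpair.1 := Primrec.fst.comp (Primrec.unpair.comp hg)

theorem primrec_unpair_snd {α : Type} [Primcodable α] {g : α → ℕ} (hg : Primrec g) :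
    Primrec fun a => (g a).unpair.2 := Primrec.snd.comp (Primrec.unpair.comp hg)

theorem primrecRel_exists_lt {β : Type} [Primcodable β] {R : ℕ → β → Prop} (hR : PrimrecRel R) :
    PrimrecRel fun n y => ∃ x < n, R x y :=
  (hR.exists_mem_list.comp (Primrec.list_range.comp Primrec.fst) Primrec.snd).of_eq (by simp)

theorem primrecRel_forall_lt {β : Type} [Primcodable β] {R : ℕ → β → Prop} (hR : PrimrecRel R) :
    PrimrecRel fun n y => ∀ x < n, R x y :=
  (hR.forall_mem_list.comp (Primrec.list_range.comp Primrec.fst) Primrec.snd).of_eq (by simp)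

/-- The map `⟨p, s⟩ ↦ s ∘ g`. -/
def sndReindex (g : ℕ → ℕ) : List Bool → ℕ → Option Bool :=
  afterReading (fun k => 2 * g k + 2) fun w k => w.getD (2 * g k + 1) false

theorem primrec_sndReindex {g : ℕ → ℕ} (hg : Primrec g) : Primrec₂ (sndReindex g) :=
  primrec_afterReading (Primrec.succ.comp (Primrec.succ.comp (primrec_two_mul hg)))
    (primrec_getD false Primrec.fst
      (Primrec.succ.comp (primrec_two_mul (hg.comp Primrec.snd))))

theorem approximates_sndReindex (g : ℕ → ℕ) (p s : Cantor) :
    Approximates (sndReindex g) (interleave p s) fun k => s (g k) :=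
  approximates_afterReading fun k m hm => by
    rw [getD_initSeg _ _ (by omega), interleave_odd]

theorem sort_wle_parallelization_sort : sort ≤ᵂ parallelization sort := by
  refine wle_of_approximates (sndReindex (Nat.pair 0))
    (afterReading (fun k => k.unpair.2 + 1) fun w k => w.getD k.unpair.2 false)
    (primrec_sndReindex (Primrec₂.natPair.comp (Primrec.const 0) Primrec.id))
    (primrec_afterReading (Primrec.succ.comp (primrec_unpair_snd Primrec.id))
      (primrec_getD false Primrec.fst (primrec_unpair_snd Primrec.snd)))
    fun p _ => ⟨fun k => p k.unpair.2, approximates_afterReading fun k m hm =>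
      getD_initSeg _ _ hm, ⟨fun k => sortFun p k.unpair.2, ?_⟩, fun s hs => ?_⟩
  · rw [sol_parallelization_sort]
    simp
  · refine ⟨_, approximates_sndReindex _ _ _, sol_sort.2 (funext fun k => ?_)⟩
    simpa using sol_parallelization_sort.1 hs 0 k

theorem isFiniteS_wle_sort : isFiniteS ≤ᵂ sort := by
  refine wle_of_approximates (sndReindex id)
    (afterReading (fun k => k + 1) fun w k => !w.getD k false) (primrec_sndReindex Primrec.id)
    (primrec_afterReading Primrec.succ
      (Primrec.not.comp (primrec_getD false Primrec.fst Primrec.snd)))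
    fun p _ => ⟨fun k => !p k, approximates_afterReading fun k m hm => by
      rw [getD_initSeg _ _ hm], ⟨_, sol_sort.2 rfl⟩, fun s hs => ?_⟩
  refine ⟨_, approximates_sndReindex _ _ _, sol_isFiniteS.2 ?_⟩
  obtain rfl := sol_sort.1 hs
  simp only [id, sortFun_eq_true, Bool.not_eq_false']
  constructor
  · intro h
    exact ⟨_, h.cast_ncard_eq.symm.le⟩
  · rintro ⟨n, hn⟩
    exact Set.finite_of_encard_le_coe hn

/-! ### Infinitely many ones and total choice -/

/-- Window `w` consists of the `2 * w + 1` positions from `w²` up to `(w + 1)²`. It holds `e w ≤ w`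
ones followed by at least one zero, so runs from different windows never merge. -/
theorem hasBlock_iff_of_windows (e : ℕ → ℕ) (he : ∀ w, e w ≤ w) (r : Cantor)
    (hr : ∀ i : ℕ, r i = decide (i < i.sqrt * i.sqrt + e i.sqrt)) (n : ℕ) :
    HasBlock r n ↔ ∃ w, e w = n + 1 := by
  have hwin : ∀ w i : ℕ, w * w ≤ i → i ≤ w * w + w + w → (r i = true ↔ i < w * w + e w) := by
    intro w i h₁ h₂
    obtain ⟨j, rfl⟩ := Nat.exists_eq_add_of_le h₁
    rw [hr, Nat.sqrt_add_eq w (by omega), decide_eq_true_eq]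
  have hlast : ∀ w, 0 < w → ∃ a, a + 1 = w * w ∧ r a = false := by
    intro w hw
    obtain ⟨v, rfl⟩ := Nat.exists_eq_add_of_lt hw
    obtain ⟨u, hu⟩ : ∃ u, u = v * v := ⟨_, rfl⟩
    have hsq : (0 + v + 1) * (0 + v + 1) = u + 2 * v + 1 := by rw [hu]; ring
    refine ⟨u + 2 * v, by omega, ?_⟩
    rw [Bool.eq_false_iff, Ne, hwin v _ (by omega) (by omega)]
    have := he v
    rcases Nat.eq_zero_or_pos v with h | h
    · subst h
      omega
    · omega
  constructor
  · rintro ⟨a, h0, h1, h2⟩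
    obtain ⟨w, hw⟩ : ∃ w, w = (a + 1).sqrt := ⟨_, rfl⟩
    have hle : w * w ≤ a + 1 := hw ▸ Nat.sqrt_le (a + 1)
    have hup : a + 1 ≤ w * w + w + w := hw ▸ Nat.sqrt_le_add (a + 1)
    have h3 := (hwin w (a + 1) hle hup).1 (h1 0 (Nat.zero_le n))
    have hew := he w
    have ha : a + 1 = w * w := by
      by_contra hne
      have := (hwin w a (by omega) (by omega)).2 (by omega)
      simp [h0] at this
    refine ⟨w, ?_⟩
    rcases lt_trichotomy (e w) (n + 1) with h | h | h
    · have := (hwin w (a + 1 + e w) (by omega) (by omega)).1 (h1 _ (by omega))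
      omega
    · exact h
    · have := (hwin w (a + n + 2) (by omega) (by omega)).2 (by omega)
      simp [h2] at this
  · rintro ⟨w, hw⟩
    have hew := he w
    obtain ⟨a, ha, hra⟩ := hlast w (by omega)
    refine ⟨a, hra, fun j hj => (hwin w _ (by omega) (by omega)).2 (by omega), ?_⟩
    rw [Bool.eq_false_iff, Ne, hwin w _ (by omega) (by omega)]
    omega

theorem primrec_sqrt : Primrec Nat.sqrt :=
  (Nat.Primrec'.sqrt.to_prim.comp
    (Primrec.vector_cons.comp Primrec.id (Primrec.const List.Vector.nil))).of_eq fun n => by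
      simp

theorem isInfiniteS_wle_totalChoiceNat : isInfiniteS ≤ᵂ totalChoiceNat := by
  refine wle_of_approximates
    (afterReading (fun k => 2 * k + 3) fun w k =>
      w.getD (2 * k + 2) false && w.getD (2 * k + 1) false)
    (afterReading (fun i => i.sqrt.unpair.2 + 1) fun w i =>
      decide (i < i.sqrt * i.sqrt + i.sqrt.unpair.1 + 1) &&
        (decide (i.sqrt.unpair.1 < i.sqrt.unpair.2) && w.getD i.sqrt.unpair.2 false)) ?_ ?_ ?_
  · refine primrec_afterReading
      (Primrec.nat_add.comp (primrec_two_mul Primrec.id) (Primrec.const 3)) ?_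
    refine Primrec.and.comp (primrec_getD false Primrec.fst ?_) (primrec_getD false Primrec.fst ?_)
    · exact Primrec.nat_add.comp (primrec_two_mul Primrec.snd) (Primrec.const 2)
    · exact Primrec.nat_add.comp (primrec_two_mul Primrec.snd) (Primrec.const 1)
  · have hs : Primrec fun a : List Bool × ℕ => a.2.sqrt := primrec_sqrt.comp Primrec.snd
    refine primrec_afterReading (Primrec.succ.comp (primrec_unpair_snd primrec_sqrt)) ?_
    refine Primrec.and.comp (PrimrecPred.decide ?_) (Primrec.and.comp (PrimrecPred.decide ?_)
      (primrec_getD false Primrec.fst (primrec_unpair_snd hs)))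
    · exact Primrec.nat_lt.comp Primrec.snd (Primrec.succ.comp
        (Primrec.nat_add.comp (Primrec.nat_mul.comp hs hs) (primrec_unpair_fst hs)))
    · exact Primrec.nat_lt.comp (primrec_unpair_fst hs) (primrec_unpair_snd hs)
  · intro p _
    -- Window `⟨n, t⟩` excludes `n` if `t` is a one of `p` beyond `n`; `n < t` also makes the `n +
    -- 1` ones fit.
    obtain ⟨r, hr⟩ : ∃ r : Cantor, r = fun i =>
        decide (i < i.sqrt * i.sqrt + i.sqrt.unpair.1 + 1) &&
        (decide (i.sqrt.unpair.1 < i.sqrt.unpair.2) && p i.sqrt.unpair.2) := ⟨_, rfl⟩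
    have hblock : ∀ n, HasBlock r n ↔ ∃ t, n < t ∧ p t = true := by
      intro n
      rw [hasBlock_iff_of_windows
        (fun w => if w.unpair.1 < w.unpair.2 ∧ p w.unpair.2 = true then w.unpair.1 + 1 else 0)
        (fun w => ?_) r (fun i => ?_) n]
      · constructor
        · rintro ⟨w, hw⟩
          split_ifs at hw with h
          · obtain rfl : w.unpair.1 = n := by omega
            exact ⟨_, h⟩
        · rintro ⟨t, ht⟩
          exact ⟨Nat.pair n t, by simp [ht]⟩
      · split_ifs with h
        · exact (Nat.succ_le_of_lt h.1).trans (Nat.unpair_right_le w)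
        · exact Nat.zero_le w
      · rw [hr, Bool.eq_iff_iff]
        have := Nat.sqrt_le i
        simp only [Bool.and_eq_true, decide_eq_true_eq]
        split_ifs with h
        · simp [h, Nat.add_assoc]
        · simp [h, this]
    have hall : {i | p i = true}.Infinite ↔ ∀ k, HasBlock r k := by
      simp only [hblock]
      constructor
      · intro h k
        obtain ⟨t, ht, hkt⟩ := h.exists_gt k
        exact ⟨t, hkt, ht⟩
      · intro h
        refine Set.infinite_of_forall_exists_gt fun k => ?_
        obtain ⟨t, hkt, ht⟩ := h k
        exact ⟨t, ht, hkt⟩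
    refine ⟨r, approximates_afterReading fun k m hm => ?_, ?_, fun s hs => ?_⟩
    · rw [getD_initSeg _ _ hm, hr]
    · by_cases h : ∀ k, HasBlock r k
      · exact ⟨_, sol_totalChoiceNat.2 ⟨0, rfl, Or.inr h⟩⟩
      · push Not at h
        obtain ⟨k, hk⟩ := h
        exact ⟨_, sol_totalChoiceNat.2 ⟨k, rfl, Or.inl hk⟩⟩
    · obtain ⟨n, rfl, hn⟩ := sol_totalChoiceNat.1 hs
      -- K looks for a one of `p` at a position `k + 1 > n`.
      refine ⟨fun k => p (k + 1) && unary n k, approximates_afterReading fun k m hm => ?_,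
        sol_isInfiniteS.2 ?_⟩
      · rw [getD_initSeg _ _ (by omega), getD_initSeg _ _ (by omega), interleave_odd,
          show 2 * k + 2 = 2 * (k + 1) by ring, interleave_even]
      · have hex : (∃ k, (p (k + 1) && unary n k) = true) ↔ HasBlock r n := by
          rw [hblock]
          simp only [Bool.and_eq_true, unary, decide_eq_true_eq]
          constructor
          · rintro ⟨k, hk, hnk⟩
            exact ⟨k + 1, by omega, hk⟩
          · rintro ⟨t, hnt, ht⟩
            exact ⟨t - 1, by rwa [Nat.sub_add_cancel (by omega)], by omega⟩
        rw [hex, hall]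
        exact ⟨fun h => h n, fun h => hn.resolve_left (not_not_intro h)⟩

/-! ### Closed choice and sorting -/

/-- Each `n < N` contributes one pair, `n` with its first stage. As stage 0 is empty, a first stage
is positive and `- 1` is a true predecessor. -/
theorem encard_first_stages (T : ℕ → ℕ → Prop) (N : ℕ) (hmono : ∀ i j n, i ≤ j → T i n → T j n)
    (h0 : ∀ n, ¬ T 0 n) (hN : ∀ n, (∃ i, T i n) ↔ n < N) :
    {k : ℕ | T k.unpair.2 k.unpair.1 ∧ ¬ T (k.unpair.2 - 1) k.unpair.1}.encard = N := by
  classical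
  have hfirst : ∀ n, ∃ i, n < N → T i n ∧ ∀ j, T j n ∧ ¬ T (j - 1) n ↔ j = i := by
    intro n
    by_cases hn : n < N
    · have hex := (hN n).2 hn
      refine ⟨Nat.find hex, fun _ => ⟨Nat.find_spec hex, fun j => ⟨fun hj => ?_, ?_⟩⟩⟩
      · refine le_antisymm ?_ (Nat.find_min' hex hj.1)
        by_contra hlt
        exact hj.2 (hmono _ _ _ (by omega) (Nat.find_spec hex))
      · rintro rfl
        refine ⟨Nat.find_spec hex, Nat.find_min hex ?_⟩
        have : Nat.find hex ≠ 0 := fun h => h0 n (h ▸ Nat.find_spec hex)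
        omega
    · exact ⟨0, fun h => absurd h hn⟩
  choose i hi using hfirst
  have : {k : ℕ | T k.unpair.2 k.unpair.1 ∧ ¬ T (k.unpair.2 - 1) k.unpair.1} =
      (fun n => Nat.pair n (i n)) '' (Set.Iio N) := by
    ext k
    simp only [Set.mem_ofPred_eq, Set.mem_image, Set.mem_Iio]
    constructor
    · intro hk
      have hlt := (hN _).1 ⟨_, hk.1⟩
      refine ⟨k.unpair.1, hlt, ?_⟩
      rw [← ((hi _ hlt).2 _).1 hk, Nat.pair_unpair]
    · rintro ⟨n, hn, rfl⟩
      simpa using ((hi n hn).2 (i n)).2 rfl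
  rw [this, Set.InjOn.encard_image]
  · rw [← Finset.coe_Iio, Set.encard_coe_eq_coe_finsetCard, Nat.card_Iio]
  · intro a _ b _ hab
    exact (Nat.pair_eq_pair.1 hab).1

/-- All of the words `0 1ʲ⁺¹ 0` for `j ≤ n` occur in `p` before position `i`. -/
def BlocksBefore (p : Cantor) (i n : ℕ) : Prop :=
  ∀ j < n + 1, ∃ a < i, a + j + 2 < i ∧ p a = false ∧ (∀ l < j + 1, p (a + 1 + l) = true) ∧
    p (a + j + 2) = false

theorem BlocksBefore.congr {p q : Cantor} {i n : ℕ} (h : Agree i p q) :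
    BlocksBefore p i n ↔ BlocksBefore q i n := by
  have key : ∀ {p q : Cantor}, Agree i p q → BlocksBefore p i n → BlocksBefore q i n := by
    intro p q h hp j hj
    obtain ⟨a, ha, hai, h0, h1, h2⟩ := hp j hj
    refine ⟨a, ha, hai, h a ha ▸ h0, fun l hl => ?_, h _ hai ▸ h2⟩
    rw [← h _ (by omega), h1 l hl]
  exact ⟨key h, key h.symm⟩

theorem BlocksBefore.mono {p : Cantor} {i j n : ℕ} (hij : i ≤ j) (h : BlocksBefore p i n) :
    BlocksBefore p j n := fun k hk => by
  obtain ⟨a, ha, hai, h'⟩ := h k hk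
  exact ⟨a, by omega, by omega, h'⟩

theorem exists_blocksBefore {p : Cantor} {n : ℕ} :
    (∃ i, BlocksBefore p i n) ↔ ∀ j ≤ n, HasBlock p j := by
  constructor
  · rintro ⟨i, hi⟩ j hj
    obtain ⟨a, -, -, h0, h1, h2⟩ := hi j (Nat.lt_succ_of_le hj)
    exact ⟨a, h0, fun l hl => h1 l (Nat.lt_succ_of_le hl), h2⟩
  · intro h
    choose! a h0 h1 h2 using h
    refine ⟨(Finset.range (n + 1)).sup a + n + 3, fun j hj => ?_⟩
    have hle : a j ≤ (Finset.range (n + 1)).sup a := Finset.le_sup (Finset.mem_range.2 hj)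
    have hj' := Nat.le_of_lt_succ hj
    exact ⟨a j, by omega, by omega, h0 j hj', fun l hl => h1 j hj' l (Nat.le_of_lt_succ hl),
      h2 j hj'⟩

theorem primrecPred_blocksBefore :
    PrimrecPred fun a : List Bool × ℕ × ℕ =>
      BlocksBefore (fun k => a.1.getD k false) a.2.1 a.2.2 := by
  have hget : ∀ {α : Type} [Primcodable α] {w : α → List Bool} {g : α → ℕ} (b : Bool),
      Primrec w → Primrec g → PrimrecPred fun a => (w a).getD (g a) false = b :=
    fun b hw hg => Primrec.eq.comp (primrec_getD false hw hg) (Primrec.const b)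
  have h1 : PrimrecRel fun (l : ℕ) (y : List Bool × ℕ) => y.1.getD (y.2 + 1 + l) false = true :=
    hget true (Primrec.fst.comp Primrec.snd)
      (Primrec.nat_add.comp (Primrec.succ.comp (Primrec.snd.comp Primrec.snd)) Primrec.fst)
  have h2 : PrimrecRel fun (a : ℕ) (y : List Bool × ℕ × ℕ) =>
      a + y.2.2 + 2 < y.2.1 ∧ y.1.getD a false = false ∧
        (∀ l < y.2.2 + 1, y.1.getD (a + 1 + l) false = true) ∧
        y.1.getD (a + y.2.2 + 2) false = false := by
    have hw : Primrec fun z : ℕ × List Bool × ℕ × ℕ => z.2.1 := Primrec.fst.comp Primrec.snd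
    have hj : Primrec fun z : ℕ × List Bool × ℕ × ℕ => z.2.2.2 :=
      Primrec.snd.comp (Primrec.snd.comp Primrec.snd)
    have he : Primrec fun z : ℕ × List Bool × ℕ × ℕ => z.1 + z.2.2.2 + 2 :=
      Primrec.succ.comp (Primrec.succ.comp (Primrec.nat_add.comp Primrec.fst hj))
    refine PrimrecPred.and (Primrec.nat_lt.comp he (Primrec.fst.comp
      (Primrec.snd.comp Primrec.snd))) (PrimrecPred.and (hget false hw Primrec.fst)
      (PrimrecPred.and ?_ (hget false hw he)))
    have h1' := primrecRel_forall_lt h1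
    exact h1'.comp (Primrec.succ.comp hj) (Primrec.pair hw Primrec.fst)
  have h3 : PrimrecRel fun (j : ℕ) (y : List Bool × ℕ) =>
      ∃ a < y.2, a + j + 2 < y.2 ∧ y.1.getD a false = false ∧
        (∀ l < j + 1, y.1.getD (a + 1 + l) false = true) ∧
        y.1.getD (a + j + 2) false = false := by
    have h2' := primrecRel_exists_lt h2
    exact h2'.comp (Primrec.snd.comp Primrec.snd) (Primrec.pair (Primrec.fst.comp Primrec.snd)
      (Primrec.pair (Primrec.snd.comp Primrec.snd) Primrec.fst))
  have h3' := primrecRel_forall_lt h3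
  exact h3'.comp (Primrec.succ.comp (Primrec.snd.comp Primrec.snd))
    (Primrec.pair Primrec.fst (Primrec.fst.comp Primrec.snd))

theorem choiceNat_wle_sort : choiceNat ≤ᵂ sort := by
  classical
  refine wle_of_approximates (sndReindex id)
    (afterReading (fun k => k.unpair.2) fun w k =>
      !decide (BlocksBefore (fun i => w.getD i false) k.unpair.2 k.unpair.1 ∧
        ¬ BlocksBefore (fun i => w.getD i false) (k.unpair.2 - 1) k.unpair.1))
    (primrec_sndReindex Primrec.id) ?_ ?_
  · refine primrec_afterReading (primrec_unpair_snd Primrec.id)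
      (Primrec.not.comp (PrimrecPred.decide ?_))
    refine PrimrecPred.and ?_ (PrimrecPred.not ?_)
    · exact primrecPred_blocksBefore.comp (Primrec.pair Primrec.fst
        (Primrec.pair (primrec_unpair_snd Primrec.snd) (primrec_unpair_fst Primrec.snd)))
    · exact primrecPred_blocksBefore.comp (Primrec.pair Primrec.fst
        (Primrec.pair (Primrec.pred.comp (primrec_unpair_snd Primrec.snd))
          (primrec_unpair_fst Primrec.snd)))
  · rintro p ⟨q, hq⟩
    obtain ⟨n, rfl, hn⟩ := sol_choiceNat.1 hq
    -- The zeros of the instance built below number exactly the least admissible `n`, so its sorted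
    -- form names that `n`.
    have hex : ∃ n, ¬ HasBlock p n := ⟨n, hn⟩
    have hcard := encard_first_stages (fun i n => BlocksBefore p i n) (Nat.find hex)
      (fun i j n hij h => h.mono hij)
      (fun n h => by
        obtain ⟨a, ha, -⟩ := h 0 (Nat.succ_pos n)
        omega)
      (fun n => by
        rw [exists_blocksBefore, Nat.lt_find_iff]
        simp only [not_not])
    refine ⟨fun k => !decide (BlocksBefore p k.unpair.2 k.unpair.1 ∧
        ¬ BlocksBefore p (k.unpair.2 - 1) k.unpair.1), approximates_afterReading fun k m hm => ?_,
      ⟨_, sol_sort.2 rfl⟩, fun s hs => ?_⟩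
    · have hag : Agree k.unpair.2 (fun i => (initSeg p m).getD i false) p :=
        fun i hi => getD_initSeg _ _ (hi.trans_le hm)
      rw [BlocksBefore.congr hag, BlocksBefore.congr (hag.mono (Nat.sub_le _ _))]
    · refine ⟨_, approximates_sndReindex _ _ _, sol_choiceNat.2 ⟨_, ?_, Nat.find_spec hex⟩⟩
      obtain rfl := sol_sort.1 hs
      refine sortFun_eq_unary ?_
      simpa only [Bool.not_eq_false', decide_eq_true_eq] using hcard

/-! ### Parallel sorting and limits -/

/-- The number of zeros of `p` before position `i`. -/
def countZeros (p : Cantor) (i : ℕ) : ℕ := ((List.range i).filter fun t => p t = false).length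

theorem countZeros_congr {p q : Cantor} {i : ℕ} (h : Agree i p q) :
    countZeros p i = countZeros q i := by
  unfold countZeros
  rw [List.filter_congr fun t ht => by rw [h t (List.mem_range.1 ht)]]

theorem coe_countZeros (p : Cantor) (i : ℕ) :
    (countZeros p i : ℕ∞) = {t | t < i ∧ p t = false}.encard := by
  have : {t | t < i ∧ p t = false} =
      (((List.range i).filter fun t => p t = false).toFinset : Set ℕ) := by
    ext t
    simp
  rw [this, Set.encard_coe_eq_coe_finsetCard,
    List.toFinset_card_of_nodup (List.nodup_range.filter _)]
  rfl

theorem eventually_lt_countZeros {p : Cantor} {m : ℕ} (h : sortFun p m = false) :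
    ∃ M, ∀ i ≥ M, m < countZeros p i := by
  have hle : ((m + 1 : ℕ) : ℕ∞) ≤ {t | p t = false}.encard := by
    rw [Bool.eq_false_iff, Ne, sortFun_eq_true, not_le] at h
    rw [Nat.cast_add, Nat.cast_one]
    exact Order.add_one_le_of_lt h
  obtain ⟨t, ht, htn⟩ := Set.exists_subset_encard_eq hle
  obtain ⟨M, hM⟩ := (Set.finite_of_encard_eq_coe htn).bddAbove
  refine ⟨M + 1, fun i hi => ?_⟩
  have hsub : t ⊆ {t | t < i ∧ p t = false} :=
    fun a ha => ⟨lt_of_lt_of_le (Nat.lt_succ_of_le (hM ha)) hi, ht ha⟩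
  have := Set.encard_le_encard hsub
  rw [htn, ← coe_countZeros, Nat.cast_le] at this
  exact this

theorem countZeros_le {p : Cantor} {m : ℕ} (h : sortFun p m = true) (i : ℕ) :
    countZeros p i ≤ m := by
  rw [sortFun_eq_true] at h
  have hsub : {t | t < i ∧ p t = false} ⊆ {t | p t = false} := fun a ha => ha.2
  have := (Set.encard_le_encard hsub).trans h
  rwa [← coe_countZeros, Nat.cast_le] at this

theorem sol_limProblem {p q : Cantor} :
    Sol limProblem p q ↔ ∃ x y : ℕ → ℕ, (∀ n j, p (Nat.pair n j) = unary (x n) j) ∧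
      (∀ n, ∃ M, ∀ i ≥ M, x (Nat.pair n i) = y n) ∧ ∀ n j, q (Nat.pair n j) = unary (y n) j := by
  have hlim : ∀ (x : ℕ → ℕ) (l : ℕ), Filter.Tendsto x Filter.atTop (nhds l) ↔
      ∃ M, ∀ i ≥ M, x i = l := fun x l => by
    rw [nhds_discrete, Filter.tendsto_pure, Filter.eventually_atTop]
  constructor
  · rintro ⟨x, y, hx, hy, hq⟩
    exact ⟨x, y, fun n j => congrFun (hx n) j, fun n => (hlim _ _).1 (hy n),
      fun n j => congrFun (hq n) j⟩
  · rintro ⟨x, y, hx, hy, hq⟩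
    exact ⟨x, y, fun n => funext (hx n), fun n => (hlim _ _).2 (hy n), fun n => funext (hq n)⟩

theorem primrec_countZeros {α : Type} [Primcodable α] {w : α → List Bool} {n i : α → ℕ}
    (hw : Primrec w) (hn : Primrec n) (hi : Primrec i) :
    Primrec fun a => countZeros (fun t => (w a).getD (Nat.pair (n a) t) false) (i a) := by
  have hR : PrimrecRel fun (t : ℕ) (y : List Bool × ℕ) =>
      y.1.getD (Nat.pair y.2 t) false = false :=
    Primrec.eq.comp (primrec_getD false (Primrec.fst.comp Primrec.snd)
      (Primrec₂.natPair.comp (Primrec.snd.comp Primrec.snd) Primrec.fst)) (Primrec.const false)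
  exact Primrec.list_length.comp ((PrimrecRel.listFilter hR).comp (Primrec.list_range.comp hi)
    (Primrec.pair hw hn))

theorem parallelization_sort_wle_limProblem : parallelization sort ≤ᵂ limProblem := by
  refine wle_of_approximates
    (sndReindex fun k => Nat.pair k 0)
    -- Here `k = ⟨⟨⟨n, m⟩, i⟩, j⟩`: bit `j` of the name of 1 or 0, according as column `n` has more
    -- than `m` zeros before `i`. The limit is 0 iff sorted bit `m` is 1, and the first bit of its
    -- name is exactly that sorted bit.
    (afterReading (fun k => Nat.pair k.unpair.1.unpair.1.unpair.1 k.unpair.1.unpair.2) fun w k =>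
      !(decide (k.unpair.1.unpair.1.unpair.2 < countZeros
        (fun t => w.getD (Nat.pair k.unpair.1.unpair.1.unpair.1 t) false) k.unpair.1.unpair.2) &&
        decide (k.unpair.2 = 0)))
    (primrec_sndReindex (Primrec₂.natPair.comp Primrec.id (Primrec.const 0))) ?_ ?_
  · have h1 : Primrec fun k : ℕ => k.unpair.1 := primrec_unpair_fst Primrec.id
    have h11 := primrec_unpair_fst h1
    have h12 := primrec_unpair_snd h1
    refine primrec_afterReading (Primrec₂.natPair.comp (primrec_unpair_fst h11) h12)
      (Primrec.not.comp (Primrec.and.comp (PrimrecPred.decide ?_) (PrimrecPred.decide ?_)))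
    · exact Primrec.nat_lt.comp ((primrec_unpair_snd h11).comp Primrec.snd)
        (primrec_countZeros Primrec.fst ((primrec_unpair_fst h11).comp Primrec.snd)
          (h12.comp Primrec.snd))
    · exact Primrec.eq.comp (primrec_unpair_snd Primrec.snd) (Primrec.const 0)
  · intro p _
    let c : ℕ → ℕ → ℕ := fun n i => countZeros (fun t => p (Nat.pair n t)) i
    let x : ℕ → ℕ := fun a =>
      if a.unpair.1.unpair.2 < c a.unpair.1.unpair.1 a.unpair.2 then 1 else 0
    let y : ℕ → ℕ := fun k =>
      if sortFun (fun t => p (Nat.pair k.unpair.1 t)) k.unpair.2 = true then 0 else 1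
    have hlim : ∀ k, ∃ M, ∀ i ≥ M, x (Nat.pair k i) = y k := by
      intro k
      cases hb : sortFun (fun t => p (Nat.pair k.unpair.1 t)) k.unpair.2 with
      | true =>
        refine ⟨0, fun i _ => ?_⟩
        simp only [x, y, c, hb, Nat.unpair_pair, if_true]
        exact if_neg (not_lt.2 (countZeros_le hb i))
      | false =>
        obtain ⟨M, hM⟩ := eventually_lt_countZeros hb
        refine ⟨M, fun i hi => ?_⟩
        simp only [x, y, c, hb, Nat.unpair_pair]
        simpa using hM i hi
    refine ⟨fun k => unary (x k.unpair.1) k.unpair.2, approximates_afterReading fun k m hm => ?_,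
      ⟨fun k => unary (y k.unpair.1) k.unpair.2, sol_limProblem.2
        ⟨x, y, by simp, hlim, by simp⟩⟩, fun s hs => ?_⟩
    · have hag : Agree k.unpair.1.unpair.2 (fun t =>
          (initSeg p m).getD (Nat.pair k.unpair.1.unpair.1.unpair.1 t) false)
          fun t => p (Nat.pair k.unpair.1.unpair.1.unpair.1 t) :=
        fun t ht => getD_initSeg _ _ ((Nat.pair_lt_pair_right _ ht).trans_le hm)
      rw [countZeros_congr hag, Bool.eq_iff_iff]
      simp only [unary, x, c, Bool.not_eq_true', Bool.and_eq_false_iff, decide_eq_false_iff_not,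
        decide_eq_true_eq]
      split_ifs with h
      · simp [h, Nat.one_le_iff_ne_zero]
      · simp [h]
    · obtain ⟨x', y', hx', hy', hs'⟩ := sol_limProblem.1 hs
      have hxx : x' = x := funext fun a => unary_injective <| funext fun j => by
        have := hx' a j
        simpa using this.symm
      refine ⟨_, approximates_sndReindex _ _ _, sol_parallelization_sort.2 fun n i => ?_⟩
      obtain ⟨M, hM⟩ := hlim (Nat.pair n i)
      obtain ⟨M', hM'⟩ := hy' (Nat.pair n i)
      have hyy : y' (Nat.pair n i) = y (Nat.pair n i) := by
        rw [← hM (max M M') (le_max_left _ _), ← hM' (max M M') (le_max_right _ _), hxx]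
      rw [hs', hyy]
      simp only [y, Nat.unpair_pair]
      cases sortFun (fun t => p (Nat.pair n t)) i <;> simp [unary]

theorem exists_sortFun_eq_true {p : Cantor} :
    (∃ t, sortFun p t = true) ↔ {i | p i = false}.Finite := by
  simp only [sortFun_eq_true]
  exact ⟨fun ⟨_, ht⟩ => Set.finite_of_encard_le_coe ht, fun h => ⟨_, h.cast_ncard_eq.symm.le⟩⟩

theorem finite_zeros_iff {p : Cantor} {b : Bool} {M : ℕ} (h : ∀ i ≥ M, p i = b) :
    {i | p i = false}.Finite ↔ b = true := by
  constructor
  · intro hfin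
    by_contra hb
    refine Set.Ici_infinite M (hfin.subset fun i hi => ?_)
    simpa [h i hi] using hb
  · rintro rfl
    refine (Set.finite_lt_nat M).subset fun i hi => ?_
    by_contra hle
    have : p i = false := hi
    rw [h i (not_lt.1 hle)] at this
    simp at this

theorem limProblem_wle_parallelization_sort : limProblem ≤ᵂ parallelization sort := by
  classical
  have hsearch : ∀ c : ℕ, PrimrecPred fun a : List Bool × ℕ =>
      ∃ t < a.1.length, a.1.getD (2 * Nat.pair (Nat.pair a.2 c) t + 1) false = true := by
    intro c
    have hR : PrimrecRel fun (t : ℕ) (a : List Bool × ℕ) =>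
        a.1.getD (2 * Nat.pair (Nat.pair a.2 c) t + 1) false = true :=
      Primrec.eq.comp (primrec_getD false (Primrec.fst.comp Primrec.snd)
        (Primrec.succ.comp (primrec_two_mul (Primrec₂.natPair.comp
          (Primrec₂.natPair.comp (Primrec.snd.comp Primrec.snd) (Primrec.const c))
          Primrec.fst)))) (Primrec.const true)
    have hR' := primrecRel_exists_lt hR
    exact hR'.comp (Primrec.list_length.comp Primrec.fst) Primrec.id
  -- For `k = ⟨⟨⟨n, j⟩, c⟩, i⟩` this is `⟨⟨n, i⟩, j⟩`, the position of bit `j` of the name of the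
  -- `i`-th approximation to the `n`-th limit. Column `c = 1` is complemented.
  let ι : ℕ → ℕ := fun k =>
    Nat.pair (Nat.pair k.unpair.1.unpair.1.unpair.1 k.unpair.2) k.unpair.1.unpair.1.unpair.2
  have hι : Primrec ι := by
    have h11 : Primrec fun k : ℕ => k.unpair.1.unpair.1 :=
      primrec_unpair_fst (primrec_unpair_fst Primrec.id)
    exact Primrec₂.natPair.comp (Primrec₂.natPair.comp (primrec_unpair_fst h11)
      (primrec_unpair_snd Primrec.id)) (primrec_unpair_snd h11)
  refine wle_of_approximates
    (fun w k =>
      if ∃ t < w.length, w.getD (2 * Nat.pair (Nat.pair k 0) t + 1) false = true then some true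
      else if ∃ t < w.length, w.getD (2 * Nat.pair (Nat.pair k 1) t + 1) false = true then
        some false
      else none)
    (afterReading (fun k => ι k + 1) fun w k =>
      w.getD (ι k) false ^^ decide (k.unpair.1.unpair.2 = 1)) ?_ ?_ ?_
  · exact Primrec.ite (hsearch 0) (Primrec.const _)
      (Primrec.ite (hsearch 1) (Primrec.const _) (Primrec.const _))
  · exact primrec_afterReading (Primrec.succ.comp hι)
      ((Primrec.dom_bool₂ (· ^^ ·)).comp
        (primrec_getD false Primrec.fst (hι.comp Primrec.snd))
        (PrimrecPred.decide (Primrec.eq.comp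
          (primrec_unpair_snd (primrec_unpair_fst Primrec.snd)) (Primrec.const 1))))
  · rintro p ⟨q, hq⟩
    obtain ⟨x, y, hx, hy, hq'⟩ := sol_limProblem.1 hq
    refine ⟨fun k => p (ι k) ^^ decide (k.unpair.1.unpair.2 = 1),
      approximates_afterReading fun k m hm => by rw [getD_initSeg _ _ hm],
      ⟨fun j => sortFun (fun i => p (ι (Nat.pair j.unpair.1 i)) ^^
        decide ((Nat.pair j.unpair.1 i).unpair.1.unpair.2 = 1)) j.unpair.2,
        sol_parallelization_sort.2 fun n i => by simp⟩, fun s hs => ⟨q, fun k => ?_, hq⟩⟩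
    -- The bits in each column are eventually constant, so its sorted form contains a one iff the
    -- limit bit is 1; of the columns `c = 0, 1` exactly one qualifies.
    have hs' : ∀ c, (∃ t, s (Nat.pair (Nat.pair k c) t) = true) ↔
        (q k ^^ decide (c = 1)) = true := by
      intro c
      obtain ⟨M, hM⟩ := hy k.unpair.1
      rw [← finite_zeros_iff (M := M)
        (p := fun i => p (ι (Nat.pair (Nat.pair k c) i)) ^^
          decide ((Nat.pair (Nat.pair k c) i).unpair.1.unpair.2 = 1)), ← exists_sortFun_eq_true]
      · simp only [sol_parallelization_sort.1 hs]
      · intro i hi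
        have h₁ := hx (Nat.pair k.unpair.1 i) k.unpair.2
        have h₂ := hq' k.unpair.1 k.unpair.2
        rw [hM i hi, ← h₂, Nat.pair_unpair] at h₁
        simp [ι, h₁]
    have hfind : ∀ c m, (∃ t < (initSeg (interleave p s) m).length,
        (initSeg (interleave p s) m).getD (2 * Nat.pair (Nat.pair k c) t + 1) false = true) →
        (q k ^^ decide (c = 1)) = true := by
      rintro c m ⟨t, -, ht⟩
      refine (hs' c).1 ⟨t, ?_⟩
      by_cases hlt : 2 * Nat.pair (Nat.pair k c) t + 1 < m
      · rwa [getD_initSeg _ _ hlt, interleave_odd] at ht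
      · rw [List.getD_eq_getElem?_getD, getElem?_initSeg, if_neg hlt] at ht
        simp at ht
    have hfound : ∀ c, (q k ^^ decide (c = 1)) = true → ∃ m₀, ∀ m ≥ m₀,
        ∃ t < (initSeg (interleave p s) m).length,
        (initSeg (interleave p s) m).getD (2 * Nat.pair (Nat.pair k c) t + 1) false = true := by
      intro c hc
      obtain ⟨t, ht⟩ := (hs' c).2 hc
      refine ⟨2 * Nat.pair (Nat.pair k c) t + 2, fun m hm => ⟨t, ?_, ?_⟩⟩
      · have := Nat.right_le_pair (Nat.pair k c) t
        simp only [length_initSeg]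
        omega
      · rw [getD_initSeg _ _ (by omega), interleave_odd, ht]
    constructor
    · intro m b hb
      dsimp only at hb
      split_ifs at hb with h₀ h₁
      · have := hfind 0 m h₀
        simp_all
      · have := hfind 1 m h₁
        simp_all
    · cases hqk : q k with
      | true =>
        obtain ⟨m₀, h₀⟩ := hfound 0 (by simp [hqk])
        refine ⟨m₀, fun m hm => ?_⟩
        dsimp only
        rw [if_pos (h₀ m hm)]
        rfl
      | false =>
        obtain ⟨m₀, h₀⟩ := hfound 1 (by simp [hqk])
        refine ⟨m₀, fun m hm => ?_⟩
        dsimp only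
        rw [if_pos (h₀ m hm)]
        split_ifs <;> rfl

end TTE

open TTE

theorem mainTheorem9 :
    (choiceNat <ᵂ sort ∧ sort <ᵂ parallelization sort ∧ parallelization sort ≡ᵂ limProblem) ∧
    isInfiniteS <ᵂ totalChoiceNat ∧
    isFiniteS <ᵂ sort ∧
    ¬ isInfiniteS ≤ᵂ sort ∧
    ¬ isFiniteS ≤ᵂ totalChoiceNat :=
  ⟨⟨⟨choiceNat_wle_sort, not_sort_wle_choiceNat⟩,
    ⟨sort_wle_parallelization_sort, not_parallelization_sort_wle_sort⟩,
    parallelization_sort_wle_limProblem, limProblem_wle_parallelization_sort⟩,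
    ⟨isInfiniteS_wle_totalChoiceNat, not_totalChoiceNat_wle_sierpinski _⟩,
    ⟨isFiniteS_wle_sort, not_sort_wle_sierpinski _⟩,
    not_isInfiniteS_wle_sort, not_isFiniteS_wle_totalChoiceNat⟩
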